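/- **Setting.** Let $\Omega\subset\mathbb R^2$ be open and convex, $a\in C^1(\Omega,\mathbb R_{>0})$, and let $\gamma\in C^0(\Omega\times\mathbb R^2,\mathbb R_{\ge0})\cap C^2(\Omega\times(\mathbb R^2\setminus\{0\}),\mathbb R_{>0})$ satisfy $\gamma(z,\lambda p)=|\lambda|\gamma(z,p)$ for all $z\in\Omega$, $p\in\mathbb R^2$, $\lambda\in\mathbb R$, and be strictly convex: for every compact $K\subset\Omega$ there is $c_K>0$ with $\gamma_{pp}(z,p)q\cdot q\ge c_K|q|^2$ for all $z\in K$ and $p,q\in\mathbb R^2$ with $p\cdot q=0$, $|p|=1$. With $p^\perp=(-p_2,p_1)$ put $\Phi(z,p)=\tfrac12a^2(z)\gamma^2(z,p^\perp)$ and, for $p\neq0$, $$H(z,p)=\frac{a^2(z)\gamma(z,p^\perp)}{|\gamma_p(z,p^\perp)|^2}\begin{pmatrix}\gamma(z,p^\perp)&\gamma_p(z,p^\perp)\cdot p\\-\gamma_p(z,p^\perp)\cdot p&\gamma(z,p^\perp)\end{pmatrix}.$$ Let $\Phi=\Phi^++\Phi^-$ with $\Phi^\pm\in C^1(\Omega\times\mathbb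 R^2)$, $z\mapsto\pm\Phi^\pm(z,p)$ convex on $\Omega$ for every $p$, and such that for every compact $K\subset\Omega$ there is $L_K\ge0$ with $|\Phi^\pm_z(z,p)-\Phi^\pm_z(z,q)|\le L_K(|p|+|q|)|p-q|$ for all $z\in K$, $p,q\in\mathbb R^2$. Let $J\ge3$, $h=1/J$, $q_j=jh$, $I=\mathbb R/\mathbb Z$, and let $V^h$ be the space of continuous maps $I\to\mathbb R^2$ that are affine on each $[q_{j-1},q_j]$, $1\le j\le J$. For piecewise continuous $u,v$ let $(u,v)^h=\tfrac12\sum_{j=1}^Jh\,[(u\cdot v)(q_j^-)+(u\cdot v)(q_{j-1}^+)]$, with one-sided limits. Given $x^m_h\in V^h$ with $\Gamma^m_h:=x^m_h(I)\subset\Omega$ and $\Delta t>0$, a solution of the scheme is an $x^{m+1}_h\in V^h$ with $\Gamma^{m+1}_h:=x^{m+1}_h(I)\subset\Omega$ such that for all $\eta_h\in V^h$ $$\tfrac1{\Delta t}\bigl(H(x^m_h,x^m_{h,\rho})(x^{m+1}_h-x^m_h),\eta_h\bigr)^h+\bigl(\Phi_p(x^m_h,x^{m+1}_{h,\rho}),\eta_{h,\rho}\bigr)^h+\bigl(\Phi^+_z(x^{m+1}_h,x^{m+1}_{h,\rho})+\Phi^-_z(x^m_h,x^{m+1}_{h,\rho}),\eta_h\bigr)^h=0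 .$$ **Theorem.** Suppose $x^m_h\in V^h$ satisfies $x^m_{h,\rho}\ne0$ on $I$ (on each element) and $\Gamma^m_h\subset\Omega$. Then there is $R>0$ with $K_0:=\{z\in\mathbb R^2:\operatorname{dist}(z,\Gamma^m_h)\le R\}\subset\Omega$. For every such $R$ there is a constant $C_0>0$ such that $$\Phi(z,p)\ge C_0|p|^2,\qquad(\Phi_p(z,q)-\Phi_p(z,p))\cdot(q-p)\ge C_0|q-p|^2\qquad\text{for all }z\in K_0,\ p,q\in\mathbb R^2,$$ and $H(x^m_h,x^m_{h,\rho})\xi\cdot\xi\ge C_0|\xi|^2$ on $I$ for all $\xi\in\mathbb R^2$. Moreover, for every such $R$ and $C_0$ and every $L_{K_0}\ge0$ for which the above Lipschitz bound holds on $K_0$, there is $\delta>0$, depending only on $R$, $C_0$, $L_{K_0}$ and the discrete energy $(\Phi(x^m_h,x^m_{h,\rho}),1)^h$, such that whenever $0<\Delta t\le\delta h$ there is exactly one solution $x^{m+1}_h\in V^h$ of the scheme with $\Gamma^{m+1}_h\subset K_0$. -/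

import Mathlib

open Set
open scoped RealInnerProductSpace

noncomputable section

namespace AnisoFlow

/-- The Euclidean plane `ℝ²`. -/
abbrev Plane : Type := EuclideanSpace ℝ (Fin 2)

/-- Anti-clockwise rotation by `π / 2`: `(p₁, p₂)^⊥ = (-p₂, p₁)`. -/
def perp (p : Plane) : Plane := !₂[-(p 1), p 0]

/-! ### The continuous data -/

/-- `a ∈ C¹(Ω, ℝ_{>0})`. -/
structure IsWeight (Ω : Set Plane) (a : Plane → ℝ) : Prop where
  contDiffOn : ContDiffOn ℝ 1 a Ω
  pos : ∀ z ∈ Ω, 0 < a z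

/-- The quadratic form of the Hessian in `p`, `γ_pp(z, p) q · q`. -/
def hessForm (γ : Plane → Plane → ℝ) (z p q : Plane) : ℝ :=
  ⟪fderiv ℝ (fun p' : Plane => gradient (γ z) p') p q, q⟫

/-- `γ` is a strictly convex anisotropy function on `Ω`: continuous and nonnegative on `Ω × ℝ²`,
of class `C²` and positive on `Ω × (ℝ² \ {0})`, absolutely homogeneous of degree one in `p`,
and strictly convex, locally uniformly in `z`. -/
structure IsAnisotropy (Ω : Set Plane) (γ : Plane → Plane → ℝ) : Prop where
  continuousOn : ContinuousOn (fun w : Plane × Plane => γ w.1 w.2) (Ω ×ˢ univ)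
  contDiffOn : ContDiffOn ℝ 2 (fun w : Plane × Plane => γ w.1 w.2) (Ω ×ˢ {0}ᶜ)
  nonneg : ∀ z ∈ Ω, ∀ p, 0 ≤ γ z p
  pos : ∀ z ∈ Ω, ∀ p, p ≠ 0 → 0 < γ z p
  homogeneous : ∀ z ∈ Ω, ∀ (p : Plane) (s : ℝ), γ z (s • p) = |s| * γ z p
  strictConvex : ∀ K : Set Plane, IsCompact K → K ⊆ Ω → ∃ c > 0,
    ∀ z ∈ K, ∀ p q : Plane, ⟪p, q⟫ = 0 → ‖p‖ = 1 → c * ‖q‖ ^ 2 ≤ hessForm γ z p q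

/-- `Φ(z, p) = ½ a(z)² γ(z, p^⊥)²`. -/
def Phi (a : Plane → ℝ) (γ : Plane → Plane → ℝ) (z p : Plane) : ℝ :=
  1 / 2 * a z ^ 2 * γ z (perp p) ^ 2

/-- The gradient `f_p(z, p)` of `p ↦ f(z, p)`. -/
def gradP (f : Plane → Plane → ℝ) (z p : Plane) : Plane := gradient (fun p' => f z p') p

/-- The gradient `f_z(z, p)` of `z ↦ f(z, p)`. -/
def gradZ (f : Plane → Plane → ℝ) (z p : Plane) : Plane := gradient (fun z' => f z' p) z

/-- The matrix `H(z, p)`. -/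
def matH (a : Plane → ℝ) (γ : Plane → Plane → ℝ) (z p : Plane) : Matrix (Fin 2) (Fin 2) ℝ :=
  (a z ^ 2 * γ z (perp p) / ‖gradP γ z (perp p)‖ ^ 2) •
    !![γ z (perp p), ⟪gradP γ z (perp p), p⟫;
       -⟪gradP γ z (perp p), p⟫, γ z (perp p)]

/-- `H(z, p) ξ`. -/
def applyH (a : Plane → ℝ) (γ : Plane → Plane → ℝ) (z p ξ : Plane) : Plane :=
  WithLp.toLp 2 (Matrix.mulVec (matH a γ z p) ξ.ofLp)

/-- The Lipschitz bound with constant `L` on `K`: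
`|f_z(z, p) - f_z(z, q)| ≤ L (|p| + |q|) |p - q|` for `z ∈ K`. -/
def GradZLipschitz (K : Set Plane) (f : Plane → Plane → ℝ) (L : ℝ) : Prop :=
  ∀ z ∈ K, ∀ p q : Plane, ‖gradZ f z p - gradZ f z q‖ ≤ L * (‖p‖ + ‖q‖) * ‖p - q‖

/-- `Φ = Φ⁺ + Φ⁻` is an admissible convex/concave splitting on `Ω`. -/
structure IsSplitting (Ω : Set Plane) (Φ Φplus Φminus : Plane → Plane → ℝ) : Prop where
  eq_add : ∀ z ∈ Ω, ∀ p, Φ z p = Φplus z p + Φminus z p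
  contDiffOn_plus : ContDiffOn ℝ 1 (fun w : Plane × Plane => Φplus w.1 w.2) (Ω ×ˢ univ)
  contDiffOn_minus : ContDiffOn ℝ 1 (fun w : Plane × Plane => Φminus w.1 w.2) (Ω ×ˢ univ)
  convex_plus : ∀ p, ConvexOn ℝ Ω (fun z => Φplus z p)
  concave_minus : ∀ p, ConvexOn ℝ Ω (fun z => -Φminus z p)
  lipschitz : ∀ K : Set Plane, IsCompact K → K ⊆ Ω →
    ∃ L ≥ 0, GradZLipschitz K Φplus L ∧ GradZLipschitz K Φminus L

/-! ### The finite element space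

Functions on `I = ℝ / ℤ` are 1-periodic functions on `ℝ`. -/

/-- The node `q_j = j h`, `h = 1 / J`. -/
def node (J j : ℕ) : ℝ := j / J

/-- The space of continuous functions `I → ℝ²` that are affine on every `[q_j, q_{j+1}]`,
`j = 0, …, J - 1`. -/
def femSpace (J : ℕ) : Set (ℝ → Plane) :=
  {χ | Continuous χ ∧ Function.Periodic χ 1 ∧
    ∀ j < J, ∃ A B : Plane, ∀ ρ ∈ Icc (node J j) (node J (j + 1)), χ ρ = A + ρ • B}

/-- The mass lumped `L²` inner product
`(u, v)^h = ½ ∑_j h [(u · v)(q_{j+1}^-) + (u · v)(q_j^+)]`, with one-sided limits at the nodes. -/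
def lumped {F : Type*} [NormedAddCommGroup F] [InnerProductSpace ℝ F]
    (J : ℕ) (u v : ℝ → F) : ℝ :=
  1 / 2 * ∑ j ∈ Finset.range J, (1 / J : ℝ) *
    (Function.leftLim (fun ρ => ⟪u ρ, v ρ⟫) (node J (j + 1)) +
      Function.rightLim (fun ρ => ⟪u ρ, v ρ⟫) (node J j))

/-- The discrete energy `(Φ(x, x_ρ), 1)^h`. -/
def energy (J : ℕ) (Φ : Plane → Plane → ℝ) (x : ℝ → Plane) : ℝ :=
  lumped J (fun ρ => Φ (x ρ) (deriv x ρ)) (fun _ => 1)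

/-- A property of the points of `I` other than the nodes, i.e. in the interior of each element
(where derivatives of finite element functions exist). -/
def OnElements (J : ℕ) (P : ℝ → Prop) : Prop :=
  ∀ j < J, ∀ ρ ∈ Ioo (node J j) (node J (j + 1)), P ρ

/-- `y = x^{m+1}_h` is a solution, with values in `Ω`, of one step of the fully discrete scheme
with time step `τ`, starting from `x = x^m_h`. -/
structure IsStep (Ω : Set Plane) (a : Plane → ℝ) (γ Φplus Φminus : Plane → Plane → ℝ)
    (J : ℕ) (τ : ℝ) (x y : ℝ → Plane) : Prop where
  mem : y ∈ femSpace J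
  range_subset : range y ⊆ Ω
  eq_zero : ∀ η ∈ femSpace J,
    1 / τ * lumped J (fun ρ => applyH a γ (x ρ) (deriv x ρ) (y ρ - x ρ)) η +
      lumped J (fun ρ => gradP (Phi a γ) (x ρ) (deriv y ρ)) (deriv η) +
      lumped J (fun ρ => gradZ Φplus (y ρ) (deriv y ρ) + gradZ Φminus (x ρ) (deriv y ρ)) η = 0

/-- The closed `R`-neighbourhood `K₀ = {z : dist(z, Γ) ≤ R}` of the curve `Γ = x(I)`. -/
def nbhd (x : ℝ → Plane) (R : ℝ) : Set Plane := {z | Metric.infDist z (range x) ≤ R}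

/-- `C₀ > 0` is a coercivity constant for `Φ` on `K₀` and for `H(x, x_ρ)` on `I`. -/
structure IsCoercivityConst (a : Plane → ℝ) (γ : Plane → Plane → ℝ) (J : ℕ) (x : ℝ → Plane)
    (K₀ : Set Plane) (C₀ : ℝ) : Prop where
  pos : 0 < C₀
  phi : ∀ z ∈ K₀, ∀ p, C₀ * ‖p‖ ^ 2 ≤ Phi a γ z p
  gradPhi : ∀ z ∈ K₀, ∀ p q : Plane,
    C₀ * ‖q - p‖ ^ 2 ≤ ⟪gradP (Phi a γ) z q - gradP (Phi a γ) z p, q - p⟫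
  matH : OnElements J fun ρ => ∀ ξ : Plane, C₀ * ‖ξ‖ ^ 2 ≤ ⟪applyH a γ (x ρ) (deriv x ρ) ξ, ξ⟫

end AnisoFlow

end

open Set
open scoped RealInnerProductSpace

noncomputable section

namespace AnisoFlow

/-! In terms of nodal values the scheme is a finite-dimensional equation F(u) = 0, with F(u) a
linear functional of the test function. Since `H` has an antisymmetric part, F need not be a
gradient, so minimisation is not available; monotonicity takes its place.

On functions whose element slopes are at most N, F is strongly monotone for small time steps
(`stepForm_strongly_monotone`). The `H` term contributes C₀/τ times the squared difference of the
values, the `Φ_p` term C₀ times the squared difference of the slopes, and convexity of `Φ⁺` in z a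
nonnegative amount. What remains is a product of the two differences with factor 4LN, absorbed by
Young's inequality when 8L²N²τ ≤ C₀².

Minty's theorem (`exists_variational_solution`) then solves the variational inequality on the
compact convex set S of functions within R of x at the nodes and with slopes at most N. Testing with
x yields the energy bound (`energy_estimate`): convexity of `Φ(x, ·)` and of `Φ⁺`, together with
concavity of `Φ⁻`, makes the non-mass terms dominate the change of energy. Each quadrature term is
at most the whole sum, which is 2J times the discrete energy. This is where the condition on τ/h
arises: with N² of order J and τJ small, the solution satisfies the constraints of S strictly, so
the inequality is an equation. Every solution with values in K₀ obeys the same bound, so strong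
monotonicity also gives uniqueness.

The coercivity constants come from the Hessian of ½N², N = γ(z, ·), which in direction v is (∇N·v)²
+ N D²N v·v. Strict convexity controls the part of v orthogonal to p, and Euler's identity ∇N·p = N
> 0 the radial part (`hessian_half_sq_lower_bound_sphere`). Integrated in mean value form along
segments, this gives strong monotonicity of `Φ_p`, uniformly on compact sets. For `H` the
antisymmetric part drops out of the quadratic form. -/

/-! ### A variational inequality for monotone operators -/

section Minty

variable {E : Type*} [NormedAddCommGroup E] [NormedSpace ℝ E]

/-- Finitely many of Minty's dual inequalities have a common solution in the convex hull. -/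
theorem exists_finite_dual_solution {ι : Type*} [Fintype ι] [Nonempty ι]
    (v : ι → E) (F : ι → E →ₗ[ℝ] ℝ)
    (hmono : ∀ i j, 0 ≤ F i (v i - v j) + F j (v j - v i)) :
    ∃ b ∈ stdSimplex ℝ ι, ∀ i, 0 ≤ F i (v i - ∑ j, b j • v j) := by
  classical
  let A : ι → ι → ℝ := fun i j => F i (v i - v j)
  let f : (ι → ℝ) → (ι → ℝ) → ℝ := fun x y => ∑ i, ∑ j, x i * y j * A i j
  have hne : (stdSimplex ℝ ι).Nonempty := ⟨_, single_mem_stdSimplex ℝ (Classical.arbitrary ι)⟩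
  have hf1 : ∀ y, IsLinearMap ℝ fun x => f x y := by
    intro y
    refine ⟨fun x x' => ?_, fun c x => ?_⟩
    · simp only [f, ← Finset.sum_add_distrib, Pi.add_apply]
      refine Finset.sum_congr rfl fun i _ => Finset.sum_congr rfl fun j _ => by ring
    · simp only [f, Pi.smul_apply, smul_eq_mul, Finset.mul_sum]
      refine Finset.sum_congr rfl fun i _ => Finset.sum_congr rfl fun j _ => by ring
  have hf2 : ∀ x, IsLinearMap ℝ fun y => f x y := by
    intro y
    refine ⟨fun x x' => ?_, fun c x => ?_⟩
    · simp only [f, ← Finset.sum_add_distrib, Pi.add_apply]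
      refine Finset.sum_congr rfl fun i _ => Finset.sum_congr rfl fun j _ => by ring
    · simp only [f, Pi.smul_apply, smul_eq_mul, Finset.mul_sum]
      refine Finset.sum_congr rfl fun i _ => Finset.sum_congr rfl fun j _ => by ring
  -- The matrix game with payoff A has a saddle point (a, b). Hence f(a, a) ≤ f(eᵢ, b) for each
  -- vertex eᵢ, and f(eᵢ, b) is the quantity to be bounded below.
  obtain ⟨a, ha, b, hb, hab⟩ := Sion.exists_isSaddlePointOn (f := f) hne
    (convex_stdSimplex ℝ ι) (isCompact_stdSimplex ℝ ι)
    (fun y _ => (by fun_prop : Continuous fun x => f x y).lowerSemicontinuous.lowerSemicontinuousOn _)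
    (fun y _ => (((hf1 y).mk' _).convexOn (convex_stdSimplex ℝ ι)).quasiconvexOn)
    (convex_stdSimplex ℝ ι) hne (isCompact_stdSimplex ℝ ι)
    (fun x _ => (by fun_prop : Continuous fun y => f x y).upperSemicontinuous.upperSemicontinuousOn _)
    (fun x _ => (((hf2 x).mk' _).concaveOn (convex_stdSimplex ℝ ι)).quasiconcaveOn)
  -- On the diagonal only the symmetric part of A counts, and monotonicity says that its entries are
  -- nonnegative.
  have haa : 0 ≤ f a a := by
    have h2 : f a a = 1 / 2 * ∑ i, ∑ j, a i * a j * (A i j + A j i) := by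
      have : f a a = ∑ i, ∑ j, a i * a j * A j i := by
        rw [Finset.sum_comm]
        exact Finset.sum_congr rfl fun i _ => Finset.sum_congr rfl fun j _ => by ring
      have h3 : ∑ i, ∑ j, a i * a j * (A i j + A j i) = f a a + f a a := by
        nth_rewrite 2 [this]
        simp only [f, ← Finset.sum_add_distrib]
        exact Finset.sum_congr rfl fun i _ => Finset.sum_congr rfl fun j _ => by ring
      rw [h3]; ring
    rw [h2]
    refine mul_nonneg (by norm_num) (Finset.sum_nonneg fun i _ => Finset.sum_nonneg fun j _ => ?_)
    exact mul_nonneg (mul_nonneg (ha.1 i) (ha.1 j)) (hmono i j)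
  refine ⟨b, hb, fun i => ?_⟩
  have h := haa.trans (hab _ (single_mem_stdSimplex ℝ i) a ha)
  have h' : f (Pi.single i 1) b = ∑ j, b j * A i j := by
    simp only [f]
    rw [Finset.sum_eq_single i]
    · simp
    · intro k _ hk; simp [hk]
    · simp
  rw [h'] at h
  have h'' : v i - ∑ j, b j • v j = ∑ j, b j • (v i - v j) := by
    simp only [smul_sub, Finset.sum_sub_distrib, ← Finset.sum_smul, hb.2, one_smul]
  rw [h'', map_sum]
  simpa [A] using h

/-- **Minty's theorem**: a monotone, continuous operator on a compact convex set admits a solution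
of the associated variational inequality. -/
theorem exists_variational_solution {K : Set E} (hK : IsCompact K) (hconv : Convex ℝ K)
    (hne : K.Nonempty) (F : E → E →ₗ[ℝ] ℝ) (hF : ∀ v, Continuous (F v))
    (hFc : ∀ w, ContinuousOn (fun u => F u w) K)
    (hmono : ∀ u ∈ K, ∀ v ∈ K, 0 ≤ F v (v - u) - F u (v - u)) :
    ∃ u ∈ K, ∀ v ∈ K, 0 ≤ F u (v - u) := by
  -- The dual inequalities cut out closed sets because each `F v` is a fixed continuous functional;
  -- compactness reduces the claim to finitely many of them.
  have hdual : (K ∩ ⋂ v : K, {u | 0 ≤ F v (v - u)}).Nonempty := by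
    refine hK.inter_iInter_nonempty _ (fun v => ?_) (fun s => ?_)
    · exact isClosed_le continuous_const ((hF v).comp (continuous_const.sub continuous_id))
    · rcases s.eq_empty_or_nonempty with rfl | hs
      · simpa using hne
      · have : Nonempty s := hs.to_subtype
        obtain ⟨b, hb, h⟩ := exists_finite_dual_solution (fun i : s => ((i : K) : E))
          (fun i => F (i : K)) (by
            intro i j
            have := hmono _ (j : K).2 _ (i : K).2
            rw [← neg_sub ((i : K) : E) (j : K), map_neg]
            linarith)
        refine ⟨∑ j, b j • ((j : K) : E), hconv.sum_mem (fun i _ => hb.1 i) hb.2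
          (fun i _ => (i : K).2), ?_⟩
        simp only [mem_iInter]
        exact fun i hi => h ⟨i, hi⟩
  obtain ⟨u, hu, hu'⟩ := hdual
  refine ⟨u, hu, fun v hv => ?_⟩
  simp only [mem_iInter, mem_ofPred_eq, Subtype.forall] at hu'
  -- Minty's trick: insert u + t(v − u) in the dual inequality, divide by t, and let t tend to 0
  -- from the right.
  have hmem : ∀ t ∈ Icc (0 : ℝ) 1, u + t • (v - u) ∈ K := fun t ht =>
    hconv.add_smul_sub_mem hu hv ht
  have hcont : ContinuousOn (fun t : ℝ => F (u + t • (v - u)) (v - u)) (Icc 0 1) :=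
    (hFc (v - u)).comp (by fun_prop) hmem
  have hpos : ∀ t ∈ Ioc (0 : ℝ) 1, 0 ≤ F (u + t • (v - u)) (v - u) := by
    intro t ht
    have := hu' _ (hmem t ⟨ht.1.le, ht.2⟩)
    rw [add_sub_cancel_left, map_smul, smul_eq_mul] at this
    exact nonneg_of_mul_nonneg_right this ht.1
  have h0 := (hcont 0 (by simp)).mono (Ioc_subset_Icc_self)
  have hlim : Filter.Tendsto (fun t : ℝ => F (u + t • (v - u)) (v - u)) (nhdsWithin 0 (Ioc 0 1))
      (nhds (F u (v - u))) := by
    simpa using h0.tendsto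
  have : (nhdsWithin (0 : ℝ) (Ioc 0 1)).NeBot := by
    rw [nhdsWithin_Ioc_eq_nhdsGT one_pos]; infer_instance
  exact ge_of_tendsto hlim (Filter.eventually_of_mem self_mem_nhdsWithin hpos)

end Minty

/-! ### Gradients -/

section Gradient

variable {E : Type*} [NormedAddCommGroup E] [InnerProductSpace ℝ E] [CompleteSpace E]

theorem hasDerivAt_along_line {f : E → ℝ} {p v : E} {t : ℝ}
    (hf : DifferentiableAt ℝ f (p + t • v)) :
    HasDerivAt (fun s : ℝ => f (p + s • v)) ⟪gradient f (p + t • v), v⟫ t := by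
  rw [inner_gradient_left]
  have h : HasDerivAt (fun s : ℝ => p + s • v) v t := by
    simpa using ((hasDerivAt_id t).smul_const v).const_add p
  exact hf.hasFDerivAt.comp_hasDerivAt t h

/-- The first order lower bound for a differentiable function with monotone gradient. -/
theorem inner_gradient_le_sub_of_monotone {f : E → ℝ} (hf : Differentiable ℝ f)
    (hmono : ∀ p q, 0 ≤ ⟪gradient f q - gradient f p, q - p⟫) (p q : E) :
    ⟪gradient f p, q - p⟫ ≤ f q - f p := by
  have hd : ∀ t : ℝ, HasDerivAt (fun s : ℝ => f (p + s • (q - p)))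
      ⟪gradient f (p + t • (q - p)), q - p⟫ t := fun t => hasDerivAt_along_line (hf _)
  obtain ⟨t, ht, h⟩ := exists_hasDerivAt_eq_slope (fun s : ℝ => f (p + s • (q - p))) _ one_pos
    (fun t _ => (hd t).continuousAt.continuousWithinAt) (fun t _ => hd t)
  -- At the mean value point, monotonicity between p and p + t(q − p), divided by t > 0, compares
  -- the two slopes.
  have h1 := hmono p (p + t • (q - p))
  rw [add_sub_cancel_left, inner_smul_right, inner_sub_left] at h1
  have h2 := nonneg_of_mul_nonneg_right h1 ht.1
  simp only [one_smul, zero_smul, add_zero, add_sub_cancel, sub_zero, div_one] at h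
  linarith

/-- The first order lower bound for a convex function. -/
theorem ConvexOn.inner_gradient_le_sub {f : E → ℝ} {s : Set E} (hf : ConvexOn ℝ s f) {x y : E}
    (hx : x ∈ s) (hy : y ∈ s) (hd : DifferentiableAt ℝ f x) :
    ⟪gradient f x, y - x⟫ ≤ f y - f x := by
  have h1 : HasDerivAt (fun t : ℝ => f (x + t • (y - x))) ⟪gradient f x, y - x⟫ 0 := by
    simpa using hasDerivAt_along_line (f := f) (p := x) (v := y - x) (t := 0) (by simpa using hd)
  have h2 := hf.comp_affineMap (AffineMap.lineMap x y : ℝ →ᵃ[ℝ] E)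
  have h3 : (f ∘ (AffineMap.lineMap x y : ℝ →ᵃ[ℝ] E)) = fun t : ℝ => f (x + t • (y - x)) := by
    funext t; simp [AffineMap.lineMap_apply_module', add_comm]
  rw [h3] at h2
  have := h2.le_slope_of_hasDerivAt (x := 0) (y := 1) (by simpa using hx) (by simpa using hy)
    one_pos h1
  simpa [slope_def_field] using this

end Gradient

/-! ### Partial gradients in z and p -/

theorem gradP_eq {f : Plane → Plane → ℝ} {z p : Plane}
    (hf : DifferentiableAt ℝ (fun w : Plane × Plane => f w.1 w.2) (z, p)) :
    gradP f z p = (InnerProductSpace.toDual ℝ Plane).symm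
      ((fderiv ℝ (fun w : Plane × Plane => f w.1 w.2) (z, p)).comp
        (ContinuousLinearMap.inr ℝ Plane Plane)) := by
  unfold gradP gradient
  congr 1
  exact (hf.hasFDerivAt.comp p (hasFDerivAt_prodMk_right z p)).fderiv

theorem gradZ_eq {f : Plane → Plane → ℝ} {z p : Plane}
    (hf : DifferentiableAt ℝ (fun w : Plane × Plane => f w.1 w.2) (z, p)) :
    gradZ f z p = (InnerProductSpace.toDual ℝ Plane).symm
      ((fderiv ℝ (fun w : Plane × Plane => f w.1 w.2) (z, p)).comp
        (ContinuousLinearMap.inl ℝ Plane Plane)) := by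
  unfold gradZ gradient
  congr 1
  exact (HasFDerivAt.comp (f := fun e => (e, p)) z hf.hasFDerivAt
    (hasFDerivAt_prodMk_left z p)).fderiv

section Continuity

variable {f : Plane → Plane → ℝ} {U : Set (Plane × Plane)}

theorem continuousOn_gradP (hU : IsOpen U)
    (hf : ContDiffOn ℝ 1 (fun w : Plane × Plane => f w.1 w.2) U) :
    ContinuousOn (fun w : Plane × Plane => gradP f w.1 w.2) U := by
  have h := hf.continuousOn_fderiv_of_isOpen hU le_rfl
  have h2 : ContinuousOn (fun w : Plane × Plane => (InnerProductSpace.toDual ℝ Plane).symm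
      ((fderiv ℝ (fun w : Plane × Plane => f w.1 w.2) w).comp
        (ContinuousLinearMap.inr ℝ Plane Plane))) U :=
    (LinearIsometryEquiv.continuous _).comp_continuousOn (h.clm_comp continuousOn_const)
  refine h2.congr fun w hw => gradP_eq ?_
  exact (hf.differentiableOn one_ne_zero).differentiableAt (hU.mem_nhds hw)

theorem continuousOn_gradZ (hU : IsOpen U)
    (hf : ContDiffOn ℝ 1 (fun w : Plane × Plane => f w.1 w.2) U) :
    ContinuousOn (fun w : Plane × Plane => gradZ f w.1 w.2) U := by
  have h := hf.continuousOn_fderiv_of_isOpen hU le_rfl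
  have h2 : ContinuousOn (fun w : Plane × Plane => (InnerProductSpace.toDual ℝ Plane).symm
      ((fderiv ℝ (fun w : Plane × Plane => f w.1 w.2) w).comp
        (ContinuousLinearMap.inl ℝ Plane Plane))) U :=
    (LinearIsometryEquiv.continuous _).comp_continuousOn (h.clm_comp continuousOn_const)
  refine h2.congr fun w hw => gradZ_eq ?_
  exact (hf.differentiableOn one_ne_zero).differentiableAt (hU.mem_nhds hw)

theorem differentiableAt_snd (hU : IsOpen U)
    (hf : ContDiffOn ℝ 1 (fun w : Plane × Plane => f w.1 w.2) U) {z p : Plane} (h : (z, p) ∈ U) :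
    DifferentiableAt ℝ (f z) p :=
  (((hf.differentiableOn one_ne_zero).differentiableAt
    (hU.mem_nhds h)).hasFDerivAt.comp p (hasFDerivAt_prodMk_right z p)).differentiableAt

theorem differentiableAt_fst (hU : IsOpen U)
    (hf : ContDiffOn ℝ 1 (fun w : Plane × Plane => f w.1 w.2) U) {z p : Plane} (h : (z, p) ∈ U) :
    DifferentiableAt ℝ (fun z' => f z' p) z :=
  (HasFDerivAt.comp (f := fun e => (e, p)) z ((hf.differentiableOn one_ne_zero).differentiableAt
    (hU.mem_nhds h)).hasFDerivAt (hasFDerivAt_prodMk_left z p)).differentiableAt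

end Continuity

/-! ### Absolutely homogeneous functions -/

section Homogeneous

variable {E : Type*} [NormedAddCommGroup E] [InnerProductSpace ℝ E] {N : E → ℝ}

theorem differentiableAt_of_contDiffOn_compl_zero (hN : ContDiffOn ℝ 2 N {0}ᶜ) {p : E}
    (hp : p ≠ 0) : DifferentiableAt ℝ N p :=
  (hN.differentiableOn two_ne_zero).differentiableAt (isOpen_compl_singleton.mem_nhds hp)

theorem hasFDerivAt_smul_comp {F : Type*} [NormedAddCommGroup F] [NormedSpace ℝ F] {f : E → F}
    {p : E} (s : ℝ) (hf : DifferentiableAt ℝ f (s • p)) :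
    HasFDerivAt (fun x => f (s • x)) (s • fderiv ℝ f (s • p)) p := by
  have h := hf.hasFDerivAt.comp p ((hasFDerivAt_id p).const_smul s)
  refine h.congr_fderiv ?_
  ext v; simp

variable [CompleteSpace E]

theorem differentiableAt_gradient_of_contDiffOn_compl_zero (hN : ContDiffOn ℝ 2 N {0}ᶜ) {p : E}
    (hp : p ≠ 0) : DifferentiableAt ℝ (gradient N) p := by
  have h : ContDiffAt ℝ 2 N p := hN.contDiffAt (isOpen_compl_singleton.mem_nhds hp)
  have h1 : DifferentiableAt ℝ (fderiv ℝ N) p :=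
    (h.fderiv_right (m := 1) (by norm_num)).differentiableAt one_ne_zero
  exact ((InnerProductSpace.toDual ℝ E).symm.toContinuousLinearEquiv.differentiableAt).comp p h1

theorem smul_gradient_smul (hN : ContDiffOn ℝ 2 N {0}ᶜ)
    (hom : ∀ (p : E) (s : ℝ), N (s • p) = |s| * N p) {p : E} (hp : p ≠ 0) {s : ℝ} (hs : s ≠ 0) :
    s • gradient N (s • p) = |s| • gradient N p := by
  have h1 := hasFDerivAt_smul_comp s
    (differentiableAt_of_contDiffOn_compl_zero hN (smul_ne_zero hs hp))
  have h2 := (differentiableAt_of_contDiffOn_compl_zero hN hp).hasFDerivAt.const_mul |s|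
  have h3 : (fun x => N (s • x)) = fun x => |s| * N x := funext fun x => hom x s
  rw [h3] at h1
  refine ext_inner_right ℝ fun v => ?_
  simpa [inner_smul_left, inner_gradient_left] using DFunLike.congr_fun (h1.unique h2) v

theorem gradient_pos_smul (hN : ContDiffOn ℝ 2 N {0}ᶜ)
    (hom : ∀ (p : E) (s : ℝ), N (s • p) = |s| * N p) {p : E} (hp : p ≠ 0) {s : ℝ} (hs : 0 < s) :
    gradient N (s • p) = gradient N p := by
  have := smul_gradient_smul hN hom hp hs.ne'
  rw [abs_of_pos hs] at this
  exact smul_right_injective E hs.ne' this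

/-- Euler's identity. -/
theorem inner_gradient_self (hN : ContDiffOn ℝ 2 N {0}ᶜ)
    (hom : ∀ (p : E) (s : ℝ), N (s • p) = |s| * N p) (p : E) (hp : p ≠ 0) :
    ⟪gradient N p, p⟫ = N p := by
  have h1 := hasDerivAt_along_line (f := N) (p := p) (v := p) (t := 0)
    (by simpa using differentiableAt_of_contDiffOn_compl_zero hN hp)
  have h2 : HasDerivAt (fun s : ℝ => (1 + s) * N p) (N p) 0 := by
    simpa using ((hasDerivAt_id (0 : ℝ)).const_add 1).mul_const (N p)
  have h3 : (fun s : ℝ => N (p + s • p)) =ᶠ[nhds 0] fun s => (1 + s) * N p := by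
    filter_upwards [lt_mem_nhds (by norm_num : (-1 : ℝ) < 0)] with s hs
    have : p + s • p = (1 + s) • p := by rw [add_smul, one_smul]
    rw [this, hom, abs_of_pos (by linarith)]
  simpa using h1.unique (h2.congr_of_eventuallyEq h3)

/-- The gradient is constant along open rays, so its radial derivative vanishes. -/
theorem fderiv_gradient_apply_self (hN : ContDiffOn ℝ 2 N {0}ᶜ)
    (hom : ∀ (p : E) (s : ℝ), N (s • p) = |s| * N p) {p : E} (hp : p ≠ 0) :
    fderiv ℝ (gradient N) p p = 0 := by
  have h0 : HasDerivAt (fun s : ℝ => p + s • p) p 0 := by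
    simpa using ((hasDerivAt_id (0 : ℝ)).smul_const p).const_add p
  have h1 : HasDerivAt (fun s : ℝ => gradient N (p + s • p)) (fderiv ℝ (gradient N) p p) 0 := by
    refine HasFDerivAt.comp_hasDerivAt (l := gradient N) (l' := fderiv ℝ (gradient N) p) 0 ?_ h0
    simpa using (differentiableAt_gradient_of_contDiffOn_compl_zero hN hp).hasFDerivAt
  have h3 : (fun s : ℝ => gradient N (p + s • p)) =ᶠ[nhds 0] fun _ => gradient N p := by
    filter_upwards [lt_mem_nhds (by norm_num : (-1 : ℝ) < 0)] with s hs
    have : p + s • p = (1 + s) • p := by rw [add_smul, one_smul]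
    rw [this, gradient_pos_smul hN hom hp (by linarith)]
  exact h1.unique ((hasDerivAt_const (0 : ℝ) (gradient N p)).congr_of_eventuallyEq h3)

/-- Differentiating Euler's identity in direction w gives D²N w·p + ∇N·w = ∇N·w. Together with the
preceding lemma this removes the radial part from both slots of the Hessian without using its
symmetry. -/
theorem inner_fderiv_gradient_self (hN : ContDiffOn ℝ 2 N {0}ᶜ)
    (hom : ∀ (p : E) (s : ℝ), N (s • p) = |s| * N p) {p : E} (hp : p ≠ 0) (w : E) :
    ⟪fderiv ℝ (gradient N) p w, p⟫ = 0 := by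
  have h1 := (differentiableAt_gradient_of_contDiffOn_compl_zero hN hp).hasFDerivAt.inner ℝ
    (hasFDerivAt_id p)
  have h2 := (differentiableAt_of_contDiffOn_compl_zero hN hp).hasFDerivAt
  have h3 : (fun x => ⟪gradient N x, id x⟫) =ᶠ[nhds p] N := by
    filter_upwards [isOpen_compl_singleton.mem_nhds hp] with x hx
    exact inner_gradient_self hN hom x hx
  have h4 := DFunLike.congr_fun (h1.unique (h2.congr_of_eventuallyEq h3)) w
  simpa [fderivInnerCLM_apply, inner_gradient_left] using h4

theorem fderiv_gradient_pos_smul (hN : ContDiffOn ℝ 2 N {0}ᶜ)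
    (hom : ∀ (p : E) (s : ℝ), N (s • p) = |s| * N p) {p : E} (hp : p ≠ 0) {s : ℝ} (hs : 0 < s) :
    s • fderiv ℝ (gradient N) (s • p) = fderiv ℝ (gradient N) p := by
  have h1 := hasFDerivAt_smul_comp s
    (differentiableAt_gradient_of_contDiffOn_compl_zero hN (smul_ne_zero hs.ne' hp))
  refine h1.unique
    ((differentiableAt_gradient_of_contDiffOn_compl_zero hN hp).hasFDerivAt.congr_of_eventuallyEq ?_)
  filter_upwards [isOpen_compl_singleton.mem_nhds hp] with x hx
  exact gradient_pos_smul hN hom hx hs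

/-- Lower bound for the Hessian of `½ N²` on the unit sphere. -/
theorem hessian_half_sq_lower_bound_sphere (hN : ContDiffOn ℝ 2 N {0}ᶜ)
    (hom : ∀ (p : E) (s : ℝ), N (s • p) = |s| * N p) {m S κ : ℝ} (hm : 0 < m) (hκ : 0 < κ)
    {r : E} (hr : ‖r‖ = 1) (hmr : m ≤ N r) (hS : ‖gradient N r‖ ≤ S)
    (hconv : ∀ w, ⟪r, w⟫ = 0 → κ * ‖w‖ ^ 2 ≤ ⟪fderiv ℝ (gradient N) r w, w⟫) (v : E) :
    ‖v‖ ^ 2 ≤ (2 / m ^ 2 + 2 * S ^ 2 / (m ^ 3 * κ) + 1 / (m * κ)) *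
      (⟪gradient N r, v⟫ ^ 2 + N r * ⟪fderiv ℝ (gradient N) r v, v⟫) := by
  have hr0 : r ≠ 0 := by rintro rfl; simp at hr
  set α := ⟪r, v⟫
  set w := v - α • r with hw
  have hrw : ⟪r, w⟫ = 0 := by
    simp [hw, inner_sub_right, inner_smul_right, hr, α]
  have hv : v = α • r + w := by simp [hw]
  have hnorm : ‖v‖ ^ 2 = α ^ 2 + ‖w‖ ^ 2 := by
    rw [hv, norm_add_sq_real, inner_smul_left, hrw, norm_smul, hr]
    simp
  have hh : ⟪fderiv ℝ (gradient N) r v, v⟫ = ⟪fderiv ℝ (gradient N) r w, w⟫ := by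
    rw [hv]
    simp only [map_add, map_smul, fderiv_gradient_apply_self hN hom hr0, smul_zero, zero_add,
      inner_add_right, inner_smul_right, inner_fderiv_gradient_self hN hom hr0, mul_zero]
  have hg : ⟪gradient N r, v⟫ = α * N r + ⟪gradient N r, w⟫ := by
    rw [hv, inner_add_right, inner_smul_right, inner_gradient_self hN hom r hr0]
  have hs : ⟪gradient N r, w⟫ ^ 2 ≤ S ^ 2 * ‖w‖ ^ 2 := by
    rw [← mul_pow, ← sq_abs]
    refine pow_le_pow_left₀ (abs_nonneg _) ((abs_real_inner_le_norm _ _).trans ?_) 2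
    exact mul_le_mul_of_nonneg_right hS (norm_nonneg _)
  rw [hnorm, hh, hg]
  set s := ⟪gradient N r, w⟫
  set n := N r
  set D := ⟪fderiv ℝ (gradient N) r w, w⟫
  have hD : κ * ‖w‖ ^ 2 ≤ D := hconv w hrw
  have hD0 : 0 ≤ D := le_trans (by positivity) hD
  set Q := (α * n + s) ^ 2 + n * D
  have hn : 0 < n := hm.trans_le hmr
  have hX : (α * n + s) ^ 2 ≤ Q := le_add_of_nonneg_right (mul_nonneg hn.le hD0)
  have hQ0 : 0 ≤ Q := le_trans (sq_nonneg _) hX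
  -- Q is the Hessian of ½N² in direction v. Its second summand bounds the tangential part w; its
  -- first then bounds the radial part α, up to the cross term s, which is controlled by w.
  have hw2 : ‖w‖ ^ 2 ≤ Q / (m * κ) := by
    rw [le_div_iff₀ (by positivity)]
    calc ‖w‖ ^ 2 * (m * κ) = m * (κ * ‖w‖ ^ 2) := by ring
      _ ≤ n * D := mul_le_mul hmr hD (by positivity) hn.le
      _ ≤ Q := le_add_of_nonneg_left (sq_nonneg _)
  have hα : α ^ 2 ≤ (2 * Q + 2 * (S ^ 2 * (Q / (m * κ)))) / m ^ 2 := by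
    rw [le_div_iff₀ (by positivity)]
    have h1 : α ^ 2 * m ^ 2 ≤ α ^ 2 * n ^ 2 :=
      mul_le_mul_of_nonneg_left (pow_le_pow_left₀ hm.le hmr 2) (sq_nonneg _)
    have h2 : α ^ 2 * n ^ 2 ≤ 2 * (α * n + s) ^ 2 + 2 * s ^ 2 := by
      nlinarith [sq_nonneg (α * n + 2 * s)]
    have h3 : S ^ 2 * ‖w‖ ^ 2 ≤ S ^ 2 * (Q / (m * κ)) :=
      mul_le_mul_of_nonneg_left hw2 (sq_nonneg _)
    linarith
  calc α ^ 2 + ‖w‖ ^ 2 ≤ (2 * Q + 2 * (S ^ 2 * (Q / (m * κ)))) / m ^ 2 + Q / (m * κ) :=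
        add_le_add hα hw2
    _ = _ := by field_simp

/-- The gradient `N ∇N` of `½ N²`. -/
def halfSqGradient (N : E → ℝ) (p : E) : E := N p • gradient N p

theorem halfSqGradient_smul (hN : ContDiffOn ℝ 2 N {0}ᶜ)
    (hom : ∀ (p : E) (s : ℝ), N (s • p) = |s| * N p) (p : E) (s : ℝ) :
    halfSqGradient N (s • p) = s • halfSqGradient N p := by
  have h0 : N 0 = 0 := by simpa using hom 0 0
  rcases eq_or_ne p 0 with rfl | hp
  · simp [halfSqGradient, h0]
  rcases eq_or_ne s 0 with rfl | hs
  · simp [halfSqGradient, h0]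
  have h := smul_gradient_smul hN hom hp hs
  -- An extra factor s is carried because the gradient is odd: s∇N(sp) = |s|∇N(p), and the two
  -- factors |s| combine to s².
  have h2 : s • halfSqGradient N (s • p) = s • s • halfSqGradient N p := by
    simp only [halfSqGradient, hom]
    rw [smul_comm, h, smul_smul, smul_smul, smul_smul]
    congr 1
    rw [mul_right_comm, abs_mul_abs_self]
  exact smul_right_injective E hs h2

theorem inner_halfSqGradient_self (hN : ContDiffOn ℝ 2 N {0}ᶜ)
    (hom : ∀ (p : E) (s : ℝ), N (s • p) = |s| * N p) (p : E) :
    ⟪halfSqGradient N p, p⟫ = N p ^ 2 := by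
  have h0 : N 0 = 0 := by simpa using hom 0 0
  rcases eq_or_ne p 0 with rfl | hp
  · simp [h0]
  rw [halfSqGradient, inner_smul_left, inner_gradient_self hN hom p hp]
  simp [sq]

/-- Strong monotonicity of the gradient of `½ N²`. -/
theorem halfSqGradient_strongly_monotone (hN : ContDiffOn ℝ 2 N {0}ᶜ)
    (hom : ∀ (p : E) (s : ℝ), N (s • p) = |s| * N p) {c : ℝ} (hc : ∀ p, c * ‖p‖ ^ 2 ≤ N p ^ 2)
    (hess : ∀ r, ‖r‖ = 1 → ∀ v,
      c * ‖v‖ ^ 2 ≤ ⟪gradient N r, v⟫ ^ 2 + N r * ⟪fderiv ℝ (gradient N) r v, v⟫) (p q : E) :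
    c * ‖q - p‖ ^ 2 ≤ ⟪halfSqGradient N q - halfSqGradient N p, q - p⟫ := by
  -- Collinear points need no Hessian: N∇N is linear on lines through 0, and its pairing with q is
  -- N(q)². This covers the segments through the origin, where N need not be differentiable.
  have hray : ∀ (q : E) (s : ℝ),
      c * ‖q - s • q‖ ^ 2 ≤ ⟪halfSqGradient N q - halfSqGradient N (s • q), q - s • q⟫ := by
    intro q s
    have h1 : q - s • q = (1 - s) • q := by rw [sub_smul, one_smul]
    have h2 : halfSqGradient N q - s • halfSqGradient N q = (1 - s) • halfSqGradient N q := by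
      rw [sub_smul, one_smul]
    rw [halfSqGradient_smul hN hom, h1, h2, inner_smul_left, inner_smul_right,
      inner_halfSqGradient_self hN hom, norm_smul, mul_pow, Real.norm_eq_abs, sq_abs]
    have := mul_le_mul_of_nonneg_left (hc q) (sq_nonneg (1 - s))
    simp only [conj_trivial]
    linarith
  by_cases hz : ∃ t ∈ Icc (0 : ℝ) 1, p + t • (q - p) = 0
  · obtain ⟨t, ht, h0⟩ := hz
    rcases eq_or_ne t 1 with rfl | ht1
    · have hq : q = (0 : ℝ) • p := by simpa using h0
      have := hray p 0
      rw [← hq] at this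
      rw [← neg_sub p q, norm_neg, inner_neg_right, ← inner_neg_left, neg_sub]
      exact this
    -- If the segment meets 0 before its end point q, then p is a nonpositive multiple of q.
    · have hp : p = (-(t / (1 - t))) • q := by
        have h1 : (1 - t) • p = (-t) • q := by
          rw [sub_smul, one_smul, neg_smul, ← sub_eq_zero, ← h0, smul_sub]; abel
        have h2 : 1 - t ≠ 0 := sub_ne_zero.mpr ht1.symm
        rw [neg_div', div_eq_inv_mul, mul_smul, ← h1, smul_smul, inv_mul_cancel₀ h2, one_smul]
      have := hray q (-(t / (1 - t)))
      rwa [← hp] at this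
  · push Not at hz
    set v := q - p
    have hd : ∀ t ∈ Icc (0 : ℝ) 1, HasDerivAt (fun s : ℝ => ⟪halfSqGradient N (p + s • v), v⟫)
        (⟪gradient N (p + t • v), v⟫ ^ 2 +
          N (p + t • v) * ⟪fderiv ℝ (gradient N) (p + t • v) v, v⟫) t := by
      intro t ht
      have hne := hz t ht
      have h0 : HasDerivAt (fun s : ℝ => p + s • v) v t := by
        simpa using ((hasDerivAt_id t).smul_const v).const_add p
      have h1 := hasDerivAt_along_line (differentiableAt_of_contDiffOn_compl_zero hN hne)
      have h2 := (differentiableAt_gradient_of_contDiffOn_compl_zero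
        hN hne).hasFDerivAt.comp_hasDerivAt t h0
      have h3 := (h1.smul h2).inner ℝ (hasDerivAt_const t v)
      refine h3.congr_deriv ?_
      simp [inner_add_left, inner_smul_left]
      ring
    obtain ⟨t, ht, h⟩ := exists_hasDerivAt_eq_slope
      (fun s : ℝ => ⟪halfSqGradient N (p + s • v), v⟫) _ one_pos
      (fun t ht => (hd t ht).continuousAt.continuousWithinAt)
      (fun t ht => hd t (Ioo_subset_Icc_self ht))
    have hq : p + (1 : ℝ) • v = q := by simp [v]
    simp only [hq, zero_smul, add_zero, sub_zero, div_one] at h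
    rw [inner_sub_left, ← h]
    -- The Hessian bound is known on the unit sphere only. It transfers to r because the Hessian of
    -- ½N² is homogeneous of degree 0: ∇N is invariant under positive scaling, N gains the factor
    -- |r|, and D²N loses it.
    set r := p + t • v with hr
    have hr0 : r ≠ 0 := hz t (Ioo_subset_Icc_self ht)
    have hrn : 0 < ‖r‖ := norm_pos_iff.mpr hr0
    set u := ‖r‖⁻¹ • r with hu
    have hun : ‖u‖ = 1 := by simp [hu, norm_smul, hrn.ne']
    have hu0 : u ≠ 0 := by rintro h; simp [h] at hun
    have hru : r = ‖r‖ • u := by rw [hu, smul_smul, mul_inv_cancel₀ hrn.ne', one_smul]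
    have h1 : gradient N r = gradient N u := by
      rw [hru, gradient_pos_smul hN hom hu0 hrn]
    have h2 : N r = ‖r‖ * N u := by
      conv_lhs => rw [hru, hom, abs_of_pos hrn]
    have h3 : ‖r‖ • fderiv ℝ (gradient N) r = fderiv ℝ (gradient N) u := by
      have := fderiv_gradient_pos_smul hN hom hu0 hrn
      rwa [← hru] at this
    have := hess u hun v
    rw [← h3] at this
    rw [h1, h2]
    simp only [smul_apply, inner_smul_left, conj_trivial] at this
    linarith

end Homogeneous

/-! ### Coercivity of the energy density -/

/-- The rotation `perp` as a continuous linear map. -/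
def perpCLM : Plane →L[ℝ] Plane :=
  LinearMap.toContinuousLinearMap
    { toFun := perp
      map_add' := fun p q => by
        ext i; fin_cases i <;> simp [perp, add_comm]
      map_smul' := fun c p => by
        ext i; fin_cases i <;> simp [perp] }

theorem perpCLM_apply (p : Plane) : perpCLM p = perp p := rfl

theorem norm_perp (p : Plane) : ‖perp p‖ = ‖p‖ := by
  simp [EuclideanSpace.norm_eq, perp, Fin.sum_univ_two, add_comm]

theorem perp_eq_zero_iff {p : Plane} : perp p = 0 ↔ p = 0 := by
  rw [← norm_eq_zero, norm_perp, norm_eq_zero]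

theorem perp_sub (p q : Plane) : perp (p - q) = perp p - perp q := map_sub perpCLM p q

theorem perp_smul (s : ℝ) (p : Plane) : perp (s • p) = s • perp p := map_smul perpCLM s p

theorem continuous_perp : Continuous perp := perpCLM.continuous

section

variable {Ω : Set Plane} {a : Plane → ℝ} {γ Φplus Φminus : Plane → Plane → ℝ}

theorem IsAnisotropy.contDiffOn_snd (hγ : IsAnisotropy Ω γ) {z : Plane} (hz : z ∈ Ω) :
    ContDiffOn ℝ 2 (γ z) {0}ᶜ :=
  hγ.contDiffOn.comp (f := fun p : Plane => (z, p)) (by fun_prop) fun _ hp => ⟨hz, hp⟩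

theorem IsSplitting.contDiffOn {Φ : Plane → Plane → ℝ} (hΦ : IsSplitting Ω Φ Φplus Φminus) :
    ContDiffOn ℝ 1 (fun w : Plane × Plane => Φ w.1 w.2) (Ω ×ˢ univ) :=
  (hΦ.contDiffOn_plus.add hΦ.contDiffOn_minus).congr fun w hw => hΦ.eq_add w.1 hw.1 w.2

/-- The chain rule for the rotation moves `Φ_p` onto the gradient of ½γ². At p = 0, where γ need not
be differentiable, `Φ` is quadratic along each line, so both sides vanish. -/
theorem inner_gradP_Phi (hγ : IsAnisotropy Ω γ) {z : Plane} (hz : z ∈ Ω)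
    (hd : DifferentiableAt ℝ (Phi a γ z) 0) (p v : Plane) :
    ⟪gradP (Phi a γ) z p, v⟫ = a z ^ 2 * ⟪halfSqGradient (γ z) (perp p), perp v⟫ := by
  have hhom := hγ.homogeneous z hz
  have h0 : γ z 0 = 0 := by simpa using hhom 0 0
  have hp0 : perp 0 = 0 := perp_eq_zero_iff.mpr rfl
  rcases eq_or_ne p 0 with rfl | hp
  · have h1 : HasDerivAt (fun t : ℝ => Phi a γ z (0 + t • v)) ⟪gradP (Phi a γ) z 0, v⟫ 0 := by
      simpa [gradP] using hasDerivAt_along_line (f := Phi a γ z) (p := 0) (v := v) (t := 0)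
        (by simpa using hd)
    have h2 : HasDerivAt (fun t : ℝ => t ^ 2 * Phi a γ z v) 0 0 := by
      simpa using (hasDerivAt_pow 2 (0 : ℝ)).mul_const (Phi a γ z v)
    have h3 : (fun t : ℝ => Phi a γ z (0 + t • v)) = fun t : ℝ => t ^ 2 * Phi a γ z v := by
      funext t
      simp only [zero_add, Phi, perp_smul, hhom, mul_pow, sq_abs]
      ring
    rw [h3] at h1
    rw [h1.unique h2]
    simp [halfSqGradient, hp0, h0]
  · have hpp : perp p ≠ 0 := mt perp_eq_zero_iff.mp hp
    have h1 := (differentiableAt_of_contDiffOn_compl_zero (hγ.contDiffOn_snd hz) hpp).hasFDerivAt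
    have h2 := (HasFDerivAt.comp p (f := perp) h1 perpCLM.hasFDerivAt).pow 2
    have h3 : HasFDerivAt (Phi a γ z) _ p := h2.const_mul (1 / 2 * a z ^ 2)
    have h4 : ⟪gradP (Phi a γ) z p, v⟫ = fderiv ℝ (Phi a γ z) p v := inner_gradient_left
    rw [h4, h3.fderiv, halfSqGradient, inner_smul_left, inner_gradient_left]
    simp [perpCLM_apply]
    ring

theorem inner_applyH (z p ξ : Plane) :
    ⟪applyH a γ z p ξ, ξ⟫ = a z ^ 2 * γ z (perp p) ^ 2 / ‖gradP γ z (perp p)‖ ^ 2 * ‖ξ‖ ^ 2 := by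
  rw [EuclideanSpace.real_norm_sq_eq ξ, Fin.sum_univ_two]
  simp [applyH, matH, PiLp.inner_apply, Fin.sum_univ_two, dotProduct]
  ring

/-- Uniform bounds for the data on a compact set. -/
theorem exists_uniform_bounds (hΩ : IsOpen Ω) (ha : IsWeight Ω a) (hγ : IsAnisotropy Ω γ)
    {K : Set Plane} (hK : IsCompact K) (hKΩ : K ⊆ Ω) :
    ∃ α > 0, ∃ m > 0, ∃ S > 0, (∀ z ∈ K, α ≤ a z) ∧ (∀ z ∈ K, ∀ p, m * ‖p‖ ≤ γ z p) ∧
      ∀ z ∈ K, ∀ p, p ≠ 0 → ‖gradP γ z p‖ ≤ S := by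
  have hsub : K ×ˢ Metric.sphere (0 : Plane) 1 ⊆ Ω ×ˢ {0}ᶜ := by
    rintro ⟨z, p⟩ ⟨hz, hp⟩
    refine ⟨hKΩ hz, ?_⟩
    rintro rfl
    simp at hp
  have hKS : IsCompact (K ×ˢ Metric.sphere (0 : Plane) 1) := hK.prod (isCompact_sphere 0 1)
  have hop : IsOpen (Ω ×ˢ ({0}ᶜ : Set Plane)) := hΩ.prod isOpen_compl_singleton
  obtain ⟨α, hα, hαK⟩ := hK.exists_forall_le' (ha.contDiffOn.continuousOn.mono hKΩ)
    (a := 0) fun z hz => ha.pos z (hKΩ hz)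
  obtain ⟨m, hm, hmK⟩ := hKS.exists_forall_le' (hγ.contDiffOn.continuousOn.mono hsub)
    (a := 0) fun w hw => hγ.pos w.1 (hsub hw).1 w.2 (hsub hw).2
  obtain ⟨S, hS⟩ := hKS.exists_bound_of_continuousOn
    ((continuousOn_gradP hop (hγ.contDiffOn.of_le one_le_two)).mono hsub)
  -- The maximum with 1 makes the gradient bound positive, since its square is later a denominator.
  -- Both bounds extend from the unit sphere by homogeneity.
  refine ⟨α, hα, m, hm, max S 1, by positivity, hαK, fun z hz p => ?_, fun z hz p hp => ?_⟩
  · rcases eq_or_ne p 0 with rfl | hp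
    · simpa using hγ.nonneg z (hKΩ hz) 0
    have hpn := norm_pos_iff.mpr hp
    have h1 := hmK (z, ‖p‖⁻¹ • p) ⟨hz, by simp [norm_smul, hpn.ne']⟩
    simp only [hγ.homogeneous z (hKΩ hz), abs_inv, abs_norm] at h1
    rwa [inv_mul_eq_div, le_div_iff₀ hpn] at h1
  · have hpn := norm_pos_iff.mpr hp
    have h1 := hS (z, ‖p‖⁻¹ • p) ⟨hz, by simp [norm_smul, hpn.ne']⟩
    have h2 : gradP γ z (‖p‖⁻¹ • p) = gradP γ z p :=
      gradient_pos_smul (hγ.contDiffOn_snd (hKΩ hz)) (hγ.homogeneous z (hKΩ hz)) hp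
        (inv_pos.mpr hpn)
    rw [h2] at h1
    exact h1.trans (le_max_left _ _)

/-- Uniform strong convexity of `Φ(z, ·)` for `z` in a compact set. -/
theorem exists_Phi_strongly_monotone (hΩ : IsOpen Ω) (ha : IsWeight Ω a) (hγ : IsAnisotropy Ω γ)
    (hd : ∀ z ∈ Ω, DifferentiableAt ℝ (Phi a γ z) 0) {K : Set Plane} (hK : IsCompact K)
    (hKΩ : K ⊆ Ω) :
    ∃ c > 0, ∀ z ∈ K, ∀ p q : Plane,
      c * ‖q - p‖ ^ 2 ≤ ⟪gradP (Phi a γ) z q - gradP (Phi a γ) z p, q - p⟫ := by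
  obtain ⟨α, hα, m, hm, S, hS, hαK, hmK, hSK⟩ := exists_uniform_bounds hΩ ha hγ hK hKΩ
  obtain ⟨κ, hκ, hκK⟩ := hγ.strictConvex K hK hKΩ
  set A := 2 / m ^ 2 + 2 * S ^ 2 / (m ^ 3 * κ) + 1 / (m * κ)
  have hA : 0 < A := by positivity
  -- A⁻¹ serves segments that avoid the origin, m² those through it.
  set c := min A⁻¹ (m ^ 2)
  have hc : 0 < c := lt_min (inv_pos.mpr hA) (by positivity)
  refine ⟨α ^ 2 * c, by positivity, fun z hz p q => ?_⟩
  have hzΩ := hKΩ hz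
  have hmono := halfSqGradient_strongly_monotone (c := c) (hγ.contDiffOn_snd hzΩ)
    (hγ.homogeneous z hzΩ) (fun p => by
      calc c * ‖p‖ ^ 2 ≤ m ^ 2 * ‖p‖ ^ 2 :=
            mul_le_mul_of_nonneg_right (min_le_right _ _) (sq_nonneg _)
        _ = (m * ‖p‖) ^ 2 := by ring
        _ ≤ γ z p ^ 2 := pow_le_pow_left₀ (by positivity) (hmK z hz p) 2)
    (fun r hr v => by
      have hr0 : r ≠ 0 := by rintro rfl; simp at hr
      have h := hessian_half_sq_lower_bound_sphere (hγ.contDiffOn_snd hzΩ)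
        (hγ.homogeneous z hzΩ) hm hκ hr (by simpa [hr] using hmK z hz r) (hSK z hz r hr0)
        (fun w hw => hκK z hz r w hw hr) v
      calc c * ‖v‖ ^ 2 ≤ A⁻¹ * ‖v‖ ^ 2 :=
            mul_le_mul_of_nonneg_right (min_le_left _ _) (sq_nonneg _)
        _ ≤ _ := by rwa [inv_mul_le_iff₀ hA]) (perp p) (perp q)
  rw [inner_sub_left, inner_gradP_Phi hγ hzΩ (hd z hzΩ), inner_gradP_Phi hγ hzΩ (hd z hzΩ),
    ← mul_sub, ← inner_sub_left, perp_sub]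
  rw [← perp_sub, norm_perp, perp_sub] at hmono
  calc α ^ 2 * c * ‖q - p‖ ^ 2 = α ^ 2 * (c * ‖q - p‖ ^ 2) := by ring
    _ ≤ _ := mul_le_mul (pow_le_pow_left₀ hα.le (hαK z hz) 2) hmono (by positivity)
      (by positivity)

end

/-! ### The scheme as a finite dimensional variational problem

The quadrature points are indexed by a finite type `ι`; `V c` and `D c` are the value and the
derivative at the quadrature point `c`. -/

section Abstract

variable {E ι : Type*} [NormedAddCommGroup E] [NormedSpace ℝ E] [Fintype ι]

/-- The left hand side of the scheme, as a linear functional of the test function. -/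
def stepForm (A : ι → Plane → Plane) (Φ Φplus Φminus : Plane → Plane → ℝ) (V D : ι → E →L[ℝ] Plane)
    (x : E) (τ : ℝ) (u : E) : E →L[ℝ] ℝ :=
  ∑ c, ((1 / τ) • (innerSL ℝ (A c (V c (u - x)))).comp (V c) +
    (innerSL ℝ (gradP Φ (V c x) (D c u))).comp (D c) +
    (innerSL ℝ (gradZ Φplus (V c u) (D c u) + gradZ Φminus (V c x) (D c u))).comp (V c))

variable {A : ι → Plane → Plane} {Φ Φplus Φminus : Plane → Plane → ℝ} {V D : ι → E →L[ℝ] Plane}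
  {x : E} {τ : ℝ} {Ω K : Set Plane} {C₀ L : ℝ}

theorem stepForm_apply (u η : E) : stepForm A Φ Φplus Φminus V D x τ u η =
    ∑ c, (1 / τ * ⟪A c (V c (u - x)), V c η⟫ + ⟪gradP Φ (V c x) (D c u), D c η⟫ +
      ⟪gradZ Φplus (V c u) (D c u) + gradZ Φminus (V c x) (D c u), V c η⟫) := by
  simp [stepForm, inner_add_left]

theorem continuousOn_stepForm (hΩ : IsOpen Ω) (hΦ : IsSplitting Ω Φ Φplus Φminus)
    (hA : ∀ c, Continuous (A c)) {S : Set E} (hS : ∀ u ∈ S, ∀ c, V c u ∈ Ω)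
    (hx : ∀ c, V c x ∈ Ω) (η : E) :
    ContinuousOn (fun u => stepForm A Φ Φplus Φminus V D x τ u η) S := by
  simp only [stepForm_apply]
  have hop : IsOpen (Ω ×ˢ (univ : Set Plane)) := hΩ.prod isOpen_univ
  refine continuousOn_finsetSum _ fun c _ => ?_
  have h1 : ContinuousOn (fun u => A c (V c (u - x))) S :=
    ((hA c).comp ((V c).continuous.comp (continuous_id.sub continuous_const))).continuousOn
  have h2 : ContinuousOn (fun u => gradP Φ (V c x) (D c u)) S :=
    (continuousOn_gradP hop hΦ.contDiffOn).comp (f := fun u => (V c x, D c u)) (by fun_prop)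
      fun u _ => ⟨hx c, mem_univ _⟩
  have h3 : ContinuousOn (fun u => gradZ Φplus (V c u) (D c u)) S :=
    (continuousOn_gradZ hop hΦ.contDiffOn_plus).comp (f := fun u => (V c u, D c u)) (by fun_prop)
      fun u hu => ⟨hS u hu c, mem_univ _⟩
  have h4 : ContinuousOn (fun u => gradZ Φminus (V c x) (D c u)) S :=
    (continuousOn_gradZ hop hΦ.contDiffOn_minus).comp (f := fun u => (V c x, D c u)) (by fun_prop)
      fun u _ => ⟨hx c, mem_univ _⟩
  fun_prop

/-- The discrete energy estimate. -/
theorem energy_estimate (hΩ : IsOpen Ω) (hΦ : IsSplitting Ω Φ Φplus Φminus) (hK : K ⊆ Ω)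
    (hA : ∀ c ξ, C₀ * ‖ξ‖ ^ 2 ≤ ⟪A c ξ, ξ⟫) (hC : 0 ≤ C₀)
    (hphi : ∀ z ∈ K, ∀ p, C₀ * ‖p‖ ^ 2 ≤ Φ z p)
    (hmono : ∀ z ∈ K, ∀ p q, C₀ * ‖q - p‖ ^ 2 ≤ ⟪gradP Φ z q - gradP Φ z p, q - p⟫)
    (hτ : 0 < τ) (hx : ∀ c, V c x ∈ K) {u : E} (hu : ∀ c, V c u ∈ K)
    (h : stepForm A Φ Φplus Φminus V D x τ u (u - x) ≤ 0) :
    ∑ c, (C₀ / τ * ‖V c (u - x)‖ ^ 2 + C₀ * ‖D c u‖ ^ 2) ≤ ∑ c, Φ (V c x) (D c x) := by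
  have hop : IsOpen (Ω ×ˢ (univ : Set Plane)) := hΩ.prod isOpen_univ
  rw [stepForm_apply] at h
  -- Pointwise, `h2` to `h4` add up to a lower bound Φ(u, u_ρ) − Φ(x, x_ρ) for the non-mass terms.
  -- The split works because `Φ⁺` is taken at the new position and `Φ⁻` at the old one.
  have key : ∀ c ∈ Finset.univ, C₀ / τ * ‖V c (u - x)‖ ^ 2 + C₀ * ‖D c u‖ ^ 2 - Φ (V c x) (D c x) ≤
      1 / τ * ⟪A c (V c (u - x)), V c (u - x)⟫ + ⟪gradP Φ (V c x) (D c u), D c (u - x)⟫ +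
      ⟪gradZ Φplus (V c u) (D c u) + gradZ Φminus (V c x) (D c u), V c (u - x)⟫ := by
    intro c _
    have hxΩ := hK (hx c)
    have huΩ := hK (hu c)
    have h1 : C₀ / τ * ‖V c (u - x)‖ ^ 2 ≤ 1 / τ * ⟪A c (V c (u - x)), V c (u - x)⟫ := by
      have := mul_le_mul_of_nonneg_left (hA c (V c (u - x))) (one_div_pos.mpr hτ).le
      calc _ = 1 / τ * (C₀ * ‖V c (u - x)‖ ^ 2) := by ring
        _ ≤ _ := this
    have h2 : ⟪gradP Φ (V c x) (D c u), D c x - D c u⟫ ≤ Φ (V c x) (D c x) - Φ (V c x) (D c u) :=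
      inner_gradient_le_sub_of_monotone
        (fun p => differentiableAt_snd hop hΦ.contDiffOn ⟨hxΩ, mem_univ _⟩)
        (fun p q => le_trans (by positivity) (hmono _ (hx c) p q)) _ _
    have h3 : ⟪gradZ Φplus (V c u) (D c u), V c x - V c u⟫ ≤
        Φplus (V c x) (D c u) - Φplus (V c u) (D c u) :=
      ConvexOn.inner_gradient_le_sub (hΦ.convex_plus _) huΩ hxΩ
        (differentiableAt_fst hop hΦ.contDiffOn_plus ⟨huΩ, mem_univ _⟩)
    have h4 : ⟪-gradZ Φminus (V c x) (D c u), V c u - V c x⟫ ≤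
        -Φminus (V c u) (D c u) - -Φminus (V c x) (D c u) := by
      have hd := differentiableAt_fst hop hΦ.contDiffOn_minus
        (z := V c x) (p := D c u) ⟨hxΩ, mem_univ _⟩
      have := ConvexOn.inner_gradient_le_sub (hΦ.concave_minus (D c u)) hxΩ huΩ hd.fun_neg
      have hneg : gradient (fun z => -Φminus z (D c u)) (V c x) = -gradZ Φminus (V c x) (D c u) := by
        simp [gradZ, gradient, fderiv_fun_neg]
      rwa [hneg] at this
    have h5 := hphi _ (hu c) (D c u)
    rw [hΦ.eq_add _ huΩ] at h5
    have h6 := hΦ.eq_add _ hxΩ (D c u)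
    simp only [map_sub, inner_add_left, inner_sub_right, inner_neg_left] at h1 h2 h3 h4 ⊢
    linarith
  have := Finset.sum_le_sum key
  rw [Finset.sum_sub_distrib] at this
  linarith

/-- Strong monotonicity of the scheme on functions with bounded derivatives. -/
theorem stepForm_strongly_monotone (hΩ : IsOpen Ω) (hΦ : IsSplitting Ω Φ Φplus Φminus) (hK : K ⊆ Ω)
    (hAsub : ∀ c ξ ζ, A c (ξ - ζ) = A c ξ - A c ζ)
    (hA : ∀ c ξ, C₀ * ‖ξ‖ ^ 2 ≤ ⟪A c ξ, ξ⟫) (hC : 0 < C₀)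
    (hmono : ∀ z ∈ K, ∀ p q, C₀ * ‖q - p‖ ^ 2 ≤ ⟪gradP Φ z q - gradP Φ z p, q - p⟫)
    (hL : 0 ≤ L) (hplus : GradZLipschitz K Φplus L) (hminus : GradZLipschitz K Φminus L)
    (hτ : 0 < τ) {N : ℝ} (hN : 8 * L ^ 2 * N ^ 2 * τ ≤ C₀ ^ 2) (hx : ∀ c, V c x ∈ K)
    {u v : E} (hu : ∀ c, V c u ∈ K) (hv : ∀ c, V c v ∈ K)
    (huN : ∀ c, ‖D c u‖ ≤ N) (hvN : ∀ c, ‖D c v‖ ≤ N) :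
    ∑ c, C₀ / (2 * τ) * ‖V c (u - v)‖ ^ 2 ≤
      stepForm A Φ Φplus Φminus V D x τ u (u - v) -
        stepForm A Φ Φplus Φminus V D x τ v (u - v) := by
  have hop : IsOpen (Ω ×ˢ (univ : Set Plane)) := hΩ.prod isOpen_univ
  rw [stepForm_apply, stepForm_apply, ← Finset.sum_sub_distrib]
  refine Finset.sum_le_sum fun c _ => ?_
  have huΩ := hK (hu c)
  have hvΩ := hK (hv c)
  set d := V c (u - v) with hd
  set e := D c (u - v) with he
  have hd' : V c u - V c v = d := (map_sub _ _ _).symm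
  have he' : D c u - D c v = e := (map_sub _ _ _).symm
  have h1 : C₀ / τ * ‖d‖ ^ 2 ≤
      1 / τ * (⟪A c (V c (u - x)), d⟫ - ⟪A c (V c (v - x)), d⟫) := by
    have hdx : d = V c (u - x) - V c (v - x) := by rw [hd, ← map_sub]; congr 1; abel
    have := mul_le_mul_of_nonneg_left (hA c d) (one_div_pos.mpr hτ).le
    rw [← inner_sub_left, ← hAsub, ← hdx]
    calc _ = 1 / τ * (C₀ * ‖d‖ ^ 2) := by ring
      _ ≤ _ := this
  have h2 : C₀ * ‖e‖ ^ 2 ≤ ⟪gradP Φ (V c x) (D c u), e⟫ - ⟪gradP Φ (V c x) (D c v), e⟫ := by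
    rw [← inner_sub_left, ← he']
    exact hmono _ (hx c) _ _
  -- With the slope frozen at that of u, `Φ⁺_z` is monotone in position. Only the change of slope is
  -- left to the Lipschitz bound, at the position of v for `Φ⁺` and at x for `Φ⁻`.
  have h3 : 0 ≤ ⟪gradZ Φplus (V c u) (D c u), d⟫ - ⟪gradZ Φplus (V c v) (D c u), d⟫ := by
    have h31 : ⟪gradZ Φplus (V c u) (D c u), V c v - V c u⟫ ≤
        Φplus (V c v) (D c u) - Φplus (V c u) (D c u) :=
      ConvexOn.inner_gradient_le_sub (hΦ.convex_plus _) huΩ hvΩ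
        (differentiableAt_fst hop hΦ.contDiffOn_plus ⟨huΩ, mem_univ _⟩)
    have h32 : ⟪gradZ Φplus (V c v) (D c u), V c u - V c v⟫ ≤
        Φplus (V c u) (D c u) - Φplus (V c v) (D c u) :=
      ConvexOn.inner_gradient_le_sub (hΦ.convex_plus _) hvΩ huΩ
        (differentiableAt_fst hop hΦ.contDiffOn_plus ⟨hvΩ, mem_univ _⟩)
    rw [← neg_sub, inner_neg_right, hd'] at h31
    rw [hd'] at h32
    linarith
  have hlip : ∀ f : Plane → Plane → ℝ, GradZLipschitz K f L → ∀ z ∈ K,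
      -(2 * L * N * ‖e‖ * ‖d‖) ≤ ⟪gradZ f z (D c u), d⟫ - ⟪gradZ f z (D c v), d⟫ := by
    intro f hf z hz
    have hb := hf z hz (D c u) (D c v)
    rw [he'] at hb
    have hb2 : L * (‖D c u‖ + ‖D c v‖) * ‖e‖ ≤ L * (2 * N) * ‖e‖ := by
      gcongr; linarith [huN c, hvN c]
    rw [← inner_sub_left]
    have h5 := abs_real_inner_le_norm (gradZ f z (D c u) - gradZ f z (D c v)) d
    have h6 := mul_le_mul_of_nonneg_right (hb.trans hb2) (norm_nonneg d)
    have h7 := neg_abs_le ⟪gradZ f z (D c u) - gradZ f z (D c v), d⟫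
    linarith
  have h4 := hlip _ hplus _ (hv c)
  have h5 := hlip _ hminus _ (hx c)
  -- Young's inequality spends the whole slope term and half of the mass term; the other half is the
  -- asserted lower bound.
  have h6 : 4 * L * N * ‖e‖ * ‖d‖ ≤ C₀ / (2 * τ) * ‖d‖ ^ 2 + C₀ * ‖e‖ ^ 2 := by
    have h61 : 4 * L * N * ‖e‖ * ‖d‖ ≤ C₀ * ‖e‖ ^ 2 + 4 * L ^ 2 * N ^ 2 / C₀ * ‖d‖ ^ 2 := by
      have := div_nonneg (sq_nonneg (C₀ * ‖e‖ - 2 * L * N * ‖d‖)) hC.le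
      have h62 : (C₀ * ‖e‖ - 2 * L * N * ‖d‖) ^ 2 / C₀ =
          C₀ * ‖e‖ ^ 2 - 4 * L * N * ‖e‖ * ‖d‖ + 4 * L ^ 2 * N ^ 2 / C₀ * ‖d‖ ^ 2 := by
        field_simp; ring
      linarith
    have h63 : 4 * L ^ 2 * N ^ 2 / C₀ ≤ C₀ / (2 * τ) := by
      rw [div_le_div_iff₀ hC (by positivity)]
      linarith
    have := mul_le_mul_of_nonneg_right h63 (sq_nonneg ‖d‖)
    linarith
  have h7 : C₀ / τ * ‖d‖ ^ 2 = C₀ / (2 * τ) * ‖d‖ ^ 2 + C₀ / (2 * τ) * ‖d‖ ^ 2 := by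
    field_simp; ring
  simp only [inner_add_left]
  linarith

/-- Existence and uniqueness for the scheme. -/
theorem existsUnique_stepForm_eq_zero (hΩ : IsOpen Ω) (hΦ : IsSplitting Ω Φ Φplus Φminus)
    (hK : K ⊆ Ω) (hAcont : ∀ c, Continuous (A c))
    (hAsub : ∀ c ξ ζ, A c (ξ - ζ) = A c ξ - A c ζ)
    (hA : ∀ c ξ, C₀ * ‖ξ‖ ^ 2 ≤ ⟪A c ξ, ξ⟫) (hC : 0 < C₀)
    (hphi : ∀ z ∈ K, ∀ p, C₀ * ‖p‖ ^ 2 ≤ Φ z p)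
    (hmono : ∀ z ∈ K, ∀ p q, C₀ * ‖q - p‖ ^ 2 ≤ ⟪gradP Φ z q - gradP Φ z p, q - p⟫)
    (hL : 0 ≤ L) (hplus : GradZLipschitz K Φplus L) (hminus : GradZLipschitz K Φminus L)
    (hτ : 0 < τ) {N R : ℝ} (hN0 : 0 ≤ N) (hR : 0 ≤ R) (hN : 8 * L ^ 2 * N ^ 2 * τ ≤ C₀ ^ 2)
    (hEN : ∑ c, Φ (V c x) (D c x) < C₀ * N ^ 2)
    (hER : ∑ c, Φ (V c x) (D c x) < C₀ / τ * R ^ 2)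
    (hball : ∀ c, Metric.closedBall (V c x) R ⊆ K)
    (hcompact : IsCompact {u : E | ∀ c, ‖V c (u - x)‖ ≤ R}) :
    (∃ u, (∀ c, ‖V c (u - x)‖ ≤ R) ∧ ∀ η, stepForm A Φ Φplus Φminus V D x τ u η = 0) ∧
    ∀ u v, (∀ c, V c u ∈ K) → (∀ c, V c v ∈ K) →
      (∀ η, stepForm A Φ Φplus Φminus V D x τ u η = 0) →
      (∀ η, stepForm A Φ Φplus Φminus V D x τ v η = 0) → ∀ c, V c u = V c v := by
  have hx : ∀ c, V c x ∈ K := fun c => hball c (Metric.mem_closedBall_self hR)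
  have hest : ∀ u, (∀ c, V c u ∈ K) → stepForm A Φ Φplus Φminus V D x τ u (u - x) ≤ 0 →
      ∀ c, ‖V c (u - x)‖ < R ∧ ‖D c u‖ < N := by
    intro u hu h c
    have h1 := energy_estimate hΩ hΦ hK hA hC.le hphi hmono hτ hx hu h
    have h2 := (Finset.single_le_sum
      (f := fun c => C₀ / τ * ‖V c (u - x)‖ ^ 2 + C₀ * ‖D c u‖ ^ 2)
      (fun c _ => by positivity) (Finset.mem_univ c)).trans h1
    have h3 : 0 ≤ C₀ / τ * ‖V c (u - x)‖ ^ 2 := by positivity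
    have h4 : 0 ≤ C₀ * ‖D c u‖ ^ 2 := by positivity
    constructor
    · refine lt_of_pow_lt_pow_left₀ 2 hR (lt_of_mul_lt_mul_left ?_ (div_pos hC hτ).le)
      linarith
    · refine lt_of_pow_lt_pow_left₀ 2 hN0 (lt_of_mul_lt_mul_left ?_ hC.le)
      linarith
  constructor
  · let S : Set E := {u | (∀ c, ‖V c (u - x)‖ ≤ R) ∧ ∀ c, ‖D c u‖ ≤ N}
    have hSK : ∀ u ∈ S, ∀ c, V c u ∈ K := fun u hu c => hball c <| by
      rw [mem_closedBall_iff_norm, ← map_sub]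
      exact hu.1 c
    have hScomp : IsCompact S := by
      have : IsClosed {u : E | ∀ c, ‖D c u‖ ≤ N} := by
        simp only [ofPred_forall]
        exact isClosed_iInter fun c => isClosed_le (by fun_prop) continuous_const
      exact hcompact.inter_right this
    have hSconv : Convex ℝ S := by
      have h1 : S = (⋂ c, (fun u => u - x) ⁻¹' (V c ⁻¹' Metric.closedBall 0 R)) ∩
          ⋂ c, D c ⁻¹' Metric.closedBall 0 N := by
        ext u; simp [S]
      rw [h1]
      refine (convex_iInter fun c => ?_).inter (convex_iInter fun c => ?_)
      · have := ((convex_closedBall (0 : Plane) R).linear_preimage (V c).toLinearMap)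
        exact this.affine_preimage (AffineMap.id ℝ E - AffineMap.const ℝ E x)
      · exact (convex_closedBall (0 : Plane) N).linear_preimage (D c).toLinearMap
    have hxS : x ∈ S := by
      -- The old iterate satisfies the slope bound by coercivity of `Φ` and the choice of N.
      refine ⟨fun c => by simpa using hR, fun c => ?_⟩
      have h1 := Finset.sum_le_sum fun c (_ : c ∈ Finset.univ) => hphi _ (hx c) (D c x)
      have h2 := (Finset.single_le_sum (f := fun c => C₀ * ‖D c x‖ ^ 2)
        (fun c _ => by positivity) (Finset.mem_univ c)).trans h1
      exact (lt_of_pow_lt_pow_left₀ 2 hN0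
        (lt_of_mul_lt_mul_left (h2.trans_lt hEN) hC.le)).le
    obtain ⟨u, huS, hvi⟩ := exists_variational_solution hScomp hSconv ⟨x, hxS⟩
      (fun u => (stepForm A Φ Φplus Φminus V D x τ u).toLinearMap)
      (fun v => (stepForm A Φ Φplus Φminus V D x τ v).continuous)
      (fun w => continuousOn_stepForm hΩ hΦ hAcont (fun u hu c => hK (hSK u hu c))
        (fun c => hK (hx c)) w)
      (fun u hu v hv => le_trans (Finset.sum_nonneg fun c _ => by positivity)
        (stepForm_strongly_monotone hΩ hΦ hK hAsub hA hC hmono hL hplus hminus hτ hN hx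
          (hSK v hv) (hSK u hu) hv.2 hu.2))
    simp only [ContinuousLinearMap.coe_coe] at hvi
    -- Testing the variational inequality with x gives the sign needed for the energy estimate, and
    -- with it strict inequality in all constraints. Small steps in every direction ±η therefore
    -- stay in S.
    have hstrict := hest u (hSK u huS) <| by
      have := hvi x hxS
      rw [← neg_sub, map_neg] at this
      linarith
    have hpos : ∀ η, 0 ≤ stepForm A Φ Φplus Φminus V D x τ u η := by
      intro η
      have h1 : ∀ᶠ t : ℝ in nhds 0, u + t • η ∈ S := by
        refine Filter.Eventually.and ?_ ?_ <;> rw [Filter.eventually_all] <;> intro c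
        · have hc : Continuous fun t : ℝ => ‖V c (u + t • η - x)‖ := by fun_prop
          exact ((hc.tendsto 0).eventually_lt_const (by simpa using (hstrict c).1)).mono
            fun t ht => le_of_lt ht
        · have hc : Continuous fun t : ℝ => ‖D c (u + t • η)‖ := by fun_prop
          exact ((hc.tendsto 0).eventually_lt_const (by simpa using (hstrict c).2)).mono
            fun t ht => le_of_lt ht
      obtain ⟨t, ht, ht0⟩ := ((h1.filter_mono nhdsWithin_le_nhds).and
        (self_mem_nhdsWithin : Ioi (0 : ℝ) ∈ nhdsWithin 0 (Ioi 0))).exists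
      have := hvi _ ht
      rw [add_sub_cancel_left, map_smul, smul_eq_mul] at this
      exact nonneg_of_mul_nonneg_right this ht0
    refine ⟨u, huS.1, fun η => le_antisymm ?_ (hpos η)⟩
    have := hpos (-η)
    rw [map_neg] at this
    linarith
  · intro u v hu hv hu0 hv0 c
    have h1 := stepForm_strongly_monotone hΩ hΦ hK hAsub hA hC hmono hL hplus hminus hτ hN hx hu hv
      (fun c => (hest u hu (hu0 _).le c).2.le) (fun c => (hest v hv (hv0 _).le c).2.le)
    rw [hu0, hv0, sub_zero] at h1
    have h2 := (Finset.single_le_sum (f := fun c => C₀ / (2 * τ) * ‖V c (u - v)‖ ^ 2)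
      (fun c _ => by positivity) (Finset.mem_univ c)).trans h1
    have h3 : ‖V c (u - v)‖ ^ 2 ≤ 0 :=
      nonpos_of_mul_nonpos_right h2 (div_pos hC (by positivity))
    have h4 : V c (u - v) = 0 := by
      rw [← norm_eq_zero]
      exact pow_eq_zero_iff two_ne_zero |>.mp (le_antisymm h3 (sq_nonneg _))
    rwa [map_sub, sub_eq_zero] at h4

end Abstract

/-! ### Nodal values of finite element functions -/

section Fem

variable {J : ℕ}

/-- The finite element function with given nodal values. -/
def interp (Y : ZMod J → Plane) (ρ : ℝ) : Plane :=
  Y (⌊ρ * J⌋ : ℤ) + Int.fract (ρ * J) • (Y ((⌊ρ * J⌋ + 1 : ℤ) : ZMod J) - Y (⌊ρ * J⌋ : ℤ))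

/-- The formula holds on the closed element: at the right end the floor jumps to n + 1, but both
affine pieces take the value `Y (n + 1)` there. -/
theorem interp_eq (Y : ZMod J → Plane) {n : ℤ} {ρ : ℝ} (hρ : ρ * J ∈ Icc (n : ℝ) (n + 1)) :
    interp Y ρ = Y n + (ρ * J - n) • (Y ((n + 1 : ℤ) : ZMod J) - Y n) := by
  rcases hρ.2.lt_or_eq with h | h
  · have hf : ⌊ρ * J⌋ = n := Int.floor_eq_iff.mpr ⟨hρ.1, h⟩
    rw [interp, Int.fract, hf]
  · have hf : ⌊ρ * J⌋ = n + 1 := Int.floor_eq_iff.mpr ⟨by push_cast; exact h.ge, by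
      push_cast; linarith⟩
    rw [interp, Int.fract, hf, h]
    push_cast
    simp

theorem periodic_interp (Y : ZMod J → Plane) : Function.Periodic (interp Y) 1 := by
  intro ρ
  have h : (ρ + 1) * (J : ℝ) = ρ * J + (J : ℕ) := by ring
  simp only [interp, h, Int.floor_add_natCast, Int.fract_add_natCast]
  simp

theorem continuous_interp (Y : ZMod J → Plane) : Continuous (interp Y) := by
  have hcl : ∀ n : ℤ, IsClosed {ρ : ℝ | ρ * J ∈ Icc (n : ℝ) (n + 1)} := fun n =>
    isClosed_Icc.preimage (continuous_mul_const (J : ℝ))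
  have hcont : ∀ n : ℤ, ContinuousOn (interp Y) {ρ : ℝ | ρ * J ∈ Icc (n : ℝ) (n + 1)} := fun n =>
    (by fun_prop : Continuous fun ρ : ℝ =>
      Y n + (ρ * J - n) • (Y ((n + 1 : ℤ) : ZMod J) - Y n)).continuousOn.congr
        fun ρ hρ => interp_eq Y hρ
  refine continuous_iff_continuousAt.mpr fun ρ => ?_
  set n := ⌊ρ * J⌋ with hn
  refine ((hcont (n - 1)).union_of_isClosed (hcont n) (hcl _) (hcl _)).continuousAt ?_
  have : (fun ρ : ℝ => ρ * J) ⁻¹' Ioo ((n : ℝ) - 1) (n + 1) ∈ nhds ρ :=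
    (continuous_mul_const (J : ℝ)).continuousAt.preimage_mem_nhds
      (Ioo_mem_nhds (by linarith [Int.floor_le (ρ * J)]) (Int.lt_floor_add_one _))
  filter_upwards [this] with s hs
  have hs' : (n : ℝ) - 1 < s * J ∧ s * J < n + 1 := hs
  rcases le_total (s * J) n with h | h
  · left
    simp only [mem_ofPred_eq, mem_Icc]
    push_cast
    constructor <;> linarith [hs'.1]
  · right
    exact ⟨h, hs'.2.le⟩

/-- The quadrature points: the two end points of each element. -/
abbrev QuadIndex (J : ℕ) : Type := Fin J × Bool

/-- The index of the node at a quadrature point. -/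
def QuadIndex.node (c : QuadIndex J) : ℕ := if c.2 then c.1 + 1 else c.1

theorem QuadIndex.node_le (c : QuadIndex J) : c.node ≤ J := by
  have := c.1.2
  unfold QuadIndex.node
  split_ifs <;> omega

/-- The constant derivative on the `j`-th element. -/
def nodalSlope (Y : ZMod J → Plane) (j : ℕ) : Plane :=
  (J : ℝ) • (Y ((j + 1 : ℕ) : ZMod J) - Y (j : ZMod J))

/-- The value at a quadrature point. -/
def quadValue (c : QuadIndex J) : (ZMod J → Plane) →L[ℝ] Plane :=
  ContinuousLinearMap.proj (R := ℝ) (φ := fun _ : ZMod J => Plane) (c.node : ZMod J)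

/-- The derivative at a quadrature point. -/
def quadSlope (c : QuadIndex J) : (ZMod J → Plane) →L[ℝ] Plane :=
  (J : ℝ) • (ContinuousLinearMap.proj (R := ℝ) (φ := fun _ : ZMod J => Plane)
    ((c.1 + 1 : ℕ) : ZMod J) - ContinuousLinearMap.proj ((c.1 : ℕ) : ZMod J))

theorem quadSlope_apply (c : QuadIndex J) (Y : ZMod J → Plane) :
    quadSlope c Y = nodalSlope Y c.1 := by
  simp [quadSlope, nodalSlope]

variable [NeZero J]

theorem cast_pos_of_neZero : (0 : ℝ) < J := Nat.cast_pos.mpr (NeZero.pos J)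

theorem node_lt_node_succ (j : ℕ) : node J j < node J (j + 1) := by
  unfold node
  gcongr
  · exact cast_pos_of_neZero
  · exact Nat.lt_succ_self j

theorem node_mul_cast (j : ℕ) : node J j * J = j := by
  rw [node, div_mul_cancel₀ _ (cast_pos_of_neZero).ne']

theorem mem_Icc_node {j : ℕ} {ρ : ℝ} :
    ρ ∈ Icc (node J j) (node J (j + 1)) ↔ ρ * J ∈ Icc (j : ℝ) (j + 1) := by
  have h := cast_pos_of_neZero (J := J)
  rw [node, node, mem_Icc, mem_Icc, div_le_iff₀ h, le_div_iff₀ h]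
  push_cast
  rfl

/-- The nodal values of a 1-periodic function. -/
def nodal (J : ℕ) (y : ℝ → Plane) : ZMod J → Plane := fun k => y (node J k.val)

/-- The case j = J is included: it wraps to node 0 in `ZMod J` and is matched by periodicity of y.
-/
theorem nodal_natCast {y : ℝ → Plane} (hy : Function.Periodic y 1) {j : ℕ} (hj : j ≤ J) :
    nodal J y j = y (node J j) := by
  rcases hj.lt_or_eq with h | h
  · rw [nodal, ZMod.val_cast_of_lt h]
  · subst h
    have h0 : node j 0 = 0 := by simp [node]
    have h1 : node j j = 0 + 1 := by
      rw [node, div_self (cast_pos_of_neZero (J := j)).ne', zero_add]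
    rw [nodal, ZMod.natCast_self, ZMod.val_zero, h0, h1, hy]

theorem eq_affine_of_mem_femSpace {y : ℝ → Plane} (hy : y ∈ femSpace J) {j : ℕ} (hj : j < J)
    {ρ : ℝ} (hρ : ρ ∈ Icc (node J j) (node J (j + 1))) :
    y ρ = y (node J j) + (ρ - node J j) • nodalSlope (nodal J y) j := by
  obtain ⟨A, B, hAB⟩ := hy.2.2 j hj
  have hle := (node_lt_node_succ (J := J) j).le
  have hB : nodalSlope (nodal J y) j = B := by
    rw [nodalSlope, nodal_natCast hy.2.1 hj.le, nodal_natCast hy.2.1 hj,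
      hAB _ (left_mem_Icc.mpr hle), hAB _ (right_mem_Icc.mpr hle), add_sub_add_left_eq_sub,
      ← sub_smul, smul_smul]
    have : (J : ℝ) * (node J (j + 1) - node J j) = 1 := by
      rw [mul_comm, sub_mul, node_mul_cast, node_mul_cast]; push_cast; ring
    rw [this, one_smul]
  rw [hB, hAB _ hρ, hAB _ (left_mem_Icc.mpr hle), sub_smul]
  abel

theorem deriv_of_mem_femSpace {y : ℝ → Plane} (hy : y ∈ femSpace J) {j : ℕ} (hj : j < J)
    {ρ : ℝ} (hρ : ρ ∈ Ioo (node J j) (node J (j + 1))) :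
    deriv y ρ = nodalSlope (nodal J y) j := by
  have h1 : HasDerivAt
      (fun ρ : ℝ => y (node J j) + (ρ - node J j) • nodalSlope (nodal J y) j)
      (nodalSlope (nodal J y) j) ρ := by
    simpa using (((hasDerivAt_id ρ).sub_const _).smul_const (nodalSlope (nodal J y) j)).const_add
      (y (node J j))
  refine (h1.congr_of_eventuallyEq ?_).deriv
  filter_upwards [Ioo_mem_nhds hρ.1 hρ.2] with s hs
  exact eq_affine_of_mem_femSpace hy hj (Ioo_subset_Icc_self hs)

theorem exists_element {ρ : ℝ} (h0 : 0 ≤ ρ) (h1 : ρ < 1) :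
    ∃ j < J, ρ ∈ Icc (node J j) (node J (j + 1)) := by
  have hJ := cast_pos_of_neZero (J := J)
  refine ⟨⌊ρ * J⌋₊, ?_, mem_Icc_node.mpr ⟨Nat.floor_le (by positivity), (Nat.lt_floor_add_one _).le⟩⟩
  rw [Nat.floor_lt (by positivity)]
  exact mul_lt_of_lt_one_left hJ h1

/-- A property of the points of `ℝ / ℤ` can be checked element by element. -/
theorem forall_of_forall_element {P : ℝ → Prop} (hP : ∀ ρ, P (Int.fract ρ) → P ρ)
    (h : ∀ j < J, ∀ ρ ∈ Icc (node J j) (node J (j + 1)), P ρ) (ρ : ℝ) : P ρ := by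
  obtain ⟨j, hj, hρ⟩ := exists_element (J := J) (Int.fract_nonneg ρ) (Int.fract_lt_one ρ)
  exact hP ρ (h j hj _ hρ)

theorem periodic_map_fract {F : Type*} {y : ℝ → F} (hy : Function.Periodic y 1) (ρ : ℝ) :
    y (Int.fract ρ) = y ρ := by
  have := hy.sub_int_mul_eq (x := ρ) ⌊ρ⌋
  rwa [mul_one] at this

theorem eq_of_nodal_eq {y z : ℝ → Plane} (hy : y ∈ femSpace J) (hz : z ∈ femSpace J)
    (h : nodal J y = nodal J z) : y = z := by
  funext ρ
  refine forall_of_forall_element (J := J) (P := fun ρ => y ρ = z ρ) (fun ρ hρ => ?_)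
    (fun j hj ρ hρ => ?_) ρ
  · rwa [periodic_map_fract hy.2.1, periodic_map_fract hz.2.1] at hρ
  · rw [eq_affine_of_mem_femSpace hy hj hρ, eq_affine_of_mem_femSpace hz hj hρ,
      ← nodal_natCast hy.2.1 hj.le, ← nodal_natCast hz.2.1 hj.le, h]

theorem interp_mem_femSpace (Y : ZMod J → Plane) : interp Y ∈ femSpace J := by
  refine ⟨continuous_interp Y, periodic_interp Y, fun j _ => ?_⟩
  refine ⟨Y j - (j : ℝ) • (Y ((j + 1 : ℤ) : ZMod J) - Y j),
    (J : ℝ) • (Y ((j + 1 : ℤ) : ZMod J) - Y j), fun ρ hρ => ?_⟩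
  have := interp_eq Y (n := j) (by exact_mod_cast mem_Icc_node.mp hρ)
  rw [this]
  push_cast
  module

theorem nodal_interp (Y : ZMod J → Plane) : nodal J (interp Y) = Y := by
  funext k
  have h := interp_eq Y (n := k.val) (ρ := node J k.val) (by
    rw [node_mul_cast]; simp)
  rw [nodal, h, node_mul_cast]
  simp

/-! ### Mass lumping -/

theorem QuadIndex.mem_Icc (c : QuadIndex J) :
    AnisoFlow.node J c.node ∈ Icc (AnisoFlow.node J c.1) (AnisoFlow.node J (c.1 + 1)) := by
  have h := (node_lt_node_succ (J := J) c.1).le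
  unfold QuadIndex.node
  split_ifs
  · exact right_mem_Icc.mpr h
  · exact left_mem_Icc.mpr h

/-- Derivatives may jump at nodes, so the integrand need only agree with `G j` inside the j-th
element. Continuity of `G j` up to the end points identifies the one-sided limits with its end point
values. -/
theorem lumped_eq {F : Type*} [NormedAddCommGroup F] [InnerProductSpace ℝ F] {u v : ℝ → F}
    {G : ℕ → ℝ → ℝ} (hG : ∀ j < J, ContinuousOn (G j) (Icc (node J j) (node J (j + 1))))
    (h : ∀ j < J, ∀ ρ ∈ Ioo (node J j) (node J (j + 1)), ⟪u ρ, v ρ⟫ = G j ρ) :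
    lumped J u v = 1 / (2 * J) * ∑ c : QuadIndex J, G c.1 (node J c.node) := by
  have hsum : ∑ c : QuadIndex J, G c.1 (node J c.node) =
      ∑ j ∈ Finset.range J, ∑ b : Bool, G j (node J (if b then j + 1 else j)) := by
    rw [Fintype.sum_prod_type, Finset.sum_range]; rfl
  rw [hsum, lumped, Finset.mul_sum, Finset.mul_sum]
  refine Finset.sum_congr rfl fun j hj => ?_
  have hj := Finset.mem_range.mp hj
  have hlt := node_lt_node_succ (J := J) j
  have h1 : Function.leftLim (fun ρ => ⟪u ρ, v ρ⟫) (node J (j + 1)) = G j (node J (j + 1)) := by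
    refine leftLim_eq_of_tendsto ?_
    have := (hG j hj _ (right_mem_Icc.mpr hlt.le)).mono Ioo_subset_Icc_self
    rw [ContinuousWithinAt, nhdsWithin_Ioo_eq_nhdsLT hlt] at this
    exact this.congr' <| Filter.eventually_of_mem (Ioo_mem_nhdsLT hlt) fun ρ hρ => (h j hj ρ hρ).symm
  have h2 : Function.rightLim (fun ρ => ⟪u ρ, v ρ⟫) (node J j) = G j (node J j) := by
    refine rightLim_eq_of_tendsto ?_
    have := (hG j hj _ (left_mem_Icc.mpr hlt.le)).mono Ioo_subset_Icc_self
    rw [ContinuousWithinAt, nhdsWithin_Ioo_eq_nhdsGT hlt] at this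
    exact this.congr' <| Filter.eventually_of_mem (Ioo_mem_nhdsGT hlt) fun ρ hρ => (h j hj ρ hρ).symm
  rw [h1, h2, Fintype.sum_bool]
  simp only [if_true, Bool.false_eq_true, if_false]
  ring

theorem quadValue_nodal {y : ℝ → Plane} (hy : Function.Periodic y 1) (c : QuadIndex J) :
    quadValue c (nodal J y) = y (node J c.node) := by
  rw [← nodal_natCast hy c.node_le]; rfl

theorem quadValue_val (k : ZMod J) (Y : ZMod J → Plane) :
    quadValue (⟨k.val, ZMod.val_lt k⟩, false) Y = Y k := by
  simp [quadValue, QuadIndex.node]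

end Fem

/-! ### The scheme in terms of nodal values -/

section Scheme

variable {Ω : Set Plane} {a : Plane → ℝ} {γ Φplus Φminus : Plane → Plane → ℝ} {x : ℝ → Plane}

theorem applyH_eq (z p ξ : Plane) : applyH a γ z p ξ =
    (a z ^ 2 * γ z (perp p) / ‖gradP γ z (perp p)‖ ^ 2) •
      (γ z (perp p) • ξ - ⟪gradP γ z (perp p), p⟫ • perp ξ) := by
  ext i
  fin_cases i <;> simp [applyH, matH, perp, dotProduct, Fin.sum_univ_two] <;> ring

theorem applyH_sub (z p ξ ζ : Plane) :
    applyH a γ z p (ξ - ζ) = applyH a γ z p ξ - applyH a γ z p ζ := by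
  rw [applyH_eq, applyH_eq, applyH_eq, perp_sub]
  module

theorem continuous_applyH (z p : Plane) : Continuous (applyH a γ z p) := by
  simp only [funext fun ξ => applyH_eq (a := a) (γ := γ) z p ξ]
  have := continuous_perp
  fun_prop

/-- By Euler's identity the gradient pairs with p to γ(z, p) > 0; hence the denominator in `matH`
does not vanish. -/
theorem IsAnisotropy.gradP_ne_zero (hγ : IsAnisotropy Ω γ) {z : Plane} (hz : z ∈ Ω) {p : Plane}
    (hp : p ≠ 0) : gradP γ z p ≠ 0 := by
  intro h
  have h1 : ⟪gradP γ z p, p⟫ = γ z p :=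
    inner_gradient_self (hγ.contDiffOn_snd hz) (hγ.homogeneous z hz) p hp
  rw [h, inner_zero_left] at h1
  exact (hγ.pos z hz p hp).ne h1

theorem continuousOn_applyH (hΩ : IsOpen Ω) (ha : IsWeight Ω a) (hγ : IsAnisotropy Ω γ) {p : Plane}
    (hp : p ≠ 0) {s : Set ℝ} {u w : ℝ → Plane} (hu : ContinuousOn u s) (hw : ContinuousOn w s)
    (hus : ∀ ρ ∈ s, u ρ ∈ Ω) : ContinuousOn (fun ρ => applyH a γ (u ρ) p (w ρ)) s := by
  simp only [applyH_eq]
  have hpp : perp p ≠ 0 := mt perp_eq_zero_iff.mp hp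
  have hop : IsOpen (Ω ×ˢ ({0}ᶜ : Set Plane)) := hΩ.prod isOpen_compl_singleton
  have hc : ContinuousOn (fun ρ => (u ρ, perp p)) s := by fun_prop
  have h1 : ContinuousOn (fun ρ => a (u ρ)) s := ha.contDiffOn.continuousOn.comp hu hus
  have h2 : ContinuousOn (fun ρ => γ (u ρ) (perp p)) s :=
    hγ.continuousOn.comp hc fun ρ hρ => ⟨hus ρ hρ, mem_univ _⟩
  have h3 : ContinuousOn (fun ρ => gradP γ (u ρ) (perp p)) s :=
    (continuousOn_gradP hop (hγ.contDiffOn.of_le one_le_two)).comp hc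
      fun ρ hρ => ⟨hus ρ hρ, hpp⟩
  have h4 : ContinuousOn (fun ρ => perp (w ρ)) s := continuous_perp.comp_continuousOn hw
  have h5 : ContinuousOn (fun ρ => a (u ρ) ^ 2 * γ (u ρ) (perp p) /
      ‖gradP γ (u ρ) (perp p)‖ ^ 2) s :=
    ((h1.pow 2).mul h2).div (h3.norm.pow 2) fun ρ hρ =>
      pow_ne_zero 2 (norm_ne_zero_iff.mpr (hγ.gradP_ne_zero (hus ρ hρ) hpp))
  have h6 : ContinuousOn (fun ρ => ⟪gradP γ (u ρ) (perp p), p⟫) s := h3.inner continuousOn_const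
  exact h5.smul ((h2.smul hw).sub (h6.smul h4))

/-! ### The neighbourhood of the curve -/

theorem nbhd_eq_cthickening {R : ℝ} (hR : 0 ≤ R) : nbhd x R = Metric.cthickening R (range x) := by
  ext z
  rw [Metric.mem_cthickening_iff, nbhd, mem_ofPred_eq, Metric.infDist,
    ENNReal.le_ofReal_iff_toReal_le (Metric.infEDist_ne_top (range_nonempty x)) hR]

theorem exists_nbhd_subset (hΩ : IsOpen Ω) (hx : IsCompact (range x)) (hxΩ : range x ⊆ Ω) :
    ∃ R > 0, nbhd x R ⊆ Ω := by
  obtain ⟨R, hR, h⟩ := hx.exists_cthickening_subset_open hΩ hxΩ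
  exact ⟨R, hR, by rwa [nbhd_eq_cthickening hR.le]⟩

theorem isCompact_nbhd (hx : IsCompact (range x)) {R : ℝ} (hR : 0 ≤ R) :
    IsCompact (nbhd x R) := by
  rw [nbhd_eq_cthickening hR]
  exact hx.cthickening

theorem closedBall_subset_nbhd (ρ R : ℝ) : Metric.closedBall (x ρ) R ⊆ nbhd x R :=
  fun _ hz => (Metric.infDist_le_dist_of_mem (mem_range_self ρ)).trans hz

variable {J : ℕ}

theorem isCompact_range_of_mem_femSpace {y : ℝ → Plane} (hy : y ∈ femSpace J) :
    IsCompact (range y) :=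
  hy.2.1.compact_of_continuous one_ne_zero hy.1

variable [NeZero J]

theorem nodalSlope_ne_zero (hx : x ∈ femSpace J) (hx' : OnElements J fun ρ => deriv x ρ ≠ 0) {j : ℕ}
    (hj : j < J) : nodalSlope (nodal J x) j ≠ 0 := by
  obtain ⟨ρ, hρ⟩ := exists_between (node_lt_node_succ (J := J) j)
  rw [← deriv_of_mem_femSpace hx hj hρ]
  exact hx' j hj ρ hρ

/-- A finite element function stays within `R` of `x` if it does so at the nodes. -/
theorem range_subset_nbhd (hx : x ∈ femSpace J) {y : ℝ → Plane} (hy : y ∈ femSpace J) {R : ℝ}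
    (h : ∀ c : QuadIndex J, ‖quadValue c (nodal J y - nodal J x)‖ ≤ R) : range y ⊆ nbhd x R := by
  rintro _ ⟨ρ, rfl⟩
  refine closedBall_subset_nbhd ρ R ?_
  rw [mem_closedBall_iff_norm]
  refine forall_of_forall_element (J := J) (P := fun ρ => ‖y ρ - x ρ‖ ≤ R) (fun ρ hρ => ?_)
    (fun j hj ρ hρ => ?_) ρ
  · rwa [periodic_map_fract hy.2.1, periodic_map_fract hx.2.1] at hρ
  have h0 := h (⟨j, hj⟩, false)
  have h1 := h (⟨j, hj⟩, true)
  rw [map_sub, quadValue_nodal hy.2.1, quadValue_nodal hx.2.1, ← mem_closedBall_zero_iff] at h0 h1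
  set t := (ρ - node J j) * J with ht
  have hρ' := mem_Icc_node.mp hρ
  have htI : t ∈ Icc (0 : ℝ) 1 := by
    rw [ht, sub_mul, node_mul_cast]
    constructor <;> linarith [hρ'.1, hρ'.2]
  -- On an element y − x is affine, hence a convex combination of its two nodal values.
  have hc := (convex_closedBall (0 : Plane) R).add_smul_sub_mem h0 h1 htI
  rw [mem_closedBall_zero_iff] at hc
  refine le_of_eq_of_le (congrArg norm ?_) hc
  rw [eq_affine_of_mem_femSpace hy hj hρ, eq_affine_of_mem_femSpace hx hj hρ, nodalSlope,
    nodalSlope, nodal_natCast hy.2.1 hj.le, nodal_natCast hy.2.1 hj, nodal_natCast hx.2.1 hj.le,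
    nodal_natCast hx.2.1 hj, smul_smul, smul_smul, ← ht]
  simp only [QuadIndex.node, if_true, Bool.false_eq_true, if_false]
  module

theorem energy_eq {Φ : Plane → Plane → ℝ} (hΦ : IsSplitting Ω Φ Φplus Φminus)
    (hx : x ∈ femSpace J) (hxΩ : range x ⊆ Ω) : energy J Φ x = 1 / (2 * J) *
      ∑ c : QuadIndex J, Φ (quadValue c (nodal J x)) (quadSlope c (nodal J x)) := by
  rw [energy, lumped_eq (G := fun j ρ => Φ (x ρ) (nodalSlope (nodal J x) j))]
  · simp only [quadValue_nodal hx.2.1, quadSlope_apply]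
  · intro j _
    exact hΦ.contDiffOn.continuousOn.comp (f := fun ρ => (x ρ, nodalSlope (nodal J x) j))
      (hx.1.prodMk continuous_const).continuousOn
      fun ρ _ => ⟨hxΩ (mem_range_self ρ), mem_univ _⟩
  · intro j hj ρ hρ
    simp [deriv_of_mem_femSpace hx hj hρ]

theorem scheme_eq_stepForm (hΩ : IsOpen Ω) (ha : IsWeight Ω a) (hγ : IsAnisotropy Ω γ)
    (hΦ : IsSplitting Ω (Phi a γ) Φplus Φminus) (hx : x ∈ femSpace J)
    (hx' : OnElements J fun ρ => deriv x ρ ≠ 0) (hxΩ : range x ⊆ Ω) (τ : ℝ) {y η : ℝ → Plane}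
    (hy : y ∈ femSpace J) (hyΩ : range y ⊆ Ω) (hη : η ∈ femSpace J) :
    1 / τ * lumped J (fun ρ => applyH a γ (x ρ) (deriv x ρ) (y ρ - x ρ)) η +
      lumped J (fun ρ => gradP (Phi a γ) (x ρ) (deriv y ρ)) (deriv η) +
      lumped J (fun ρ => gradZ Φplus (y ρ) (deriv y ρ) + gradZ Φminus (x ρ) (deriv y ρ)) η =
    1 / (2 * J) * stepForm
      (fun c : QuadIndex J => applyH a γ (quadValue c (nodal J x)) (quadSlope c (nodal J x)))
      (Phi a γ) Φplus Φminus quadValue quadSlope (nodal J x) τ (nodal J y) (nodal J η) := by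
  have hop : IsOpen (Ω ×ˢ (univ : Set Plane)) := hΩ.prod isOpen_univ
  have hxm : ∀ ρ, x ρ ∈ Ω := fun ρ => hxΩ (mem_range_self ρ)
  have hym : ∀ ρ, y ρ ∈ Ω := fun ρ => hyΩ (mem_range_self ρ)
  rw [lumped_eq (G := fun j ρ => ⟪applyH a γ (x ρ) (nodalSlope (nodal J x) j) (y ρ - x ρ), η ρ⟫),
    lumped_eq (G := fun j ρ => ⟪gradP (Phi a γ) (x ρ) (nodalSlope (nodal J y) j),
      nodalSlope (nodal J η) j⟫),
    lumped_eq (G := fun j ρ => ⟪gradZ Φplus (y ρ) (nodalSlope (nodal J y) j) +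
      gradZ Φminus (x ρ) (nodalSlope (nodal J y) j), η ρ⟫), stepForm_apply]
  · simp only [Finset.sum_add_distrib, ← Finset.mul_sum, map_sub, quadValue_nodal hx.2.1,
      quadValue_nodal hy.2.1, quadValue_nodal hη.2.1, quadSlope_apply]
    ring
  · intro j _
    refine ContinuousOn.inner ?_ hη.1.continuousOn
    refine ContinuousOn.add ?_ ?_
    · exact (continuousOn_gradZ hop hΦ.contDiffOn_plus).comp
        (f := fun ρ => (y ρ, nodalSlope (nodal J y) j))
        (hy.1.prodMk continuous_const).continuousOn fun ρ _ => ⟨hym ρ, mem_univ _⟩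
    · exact (continuousOn_gradZ hop hΦ.contDiffOn_minus).comp
        (f := fun ρ => (x ρ, nodalSlope (nodal J y) j))
        (hx.1.prodMk continuous_const).continuousOn fun ρ _ => ⟨hxm ρ, mem_univ _⟩
  · intro j hj ρ hρ
    rw [deriv_of_mem_femSpace hy hj hρ]
  · intro j _
    refine ContinuousOn.inner ?_ continuousOn_const
    exact (continuousOn_gradP hop hΦ.contDiffOn).comp
      (f := fun ρ => (x ρ, nodalSlope (nodal J y) j))
      (hx.1.prodMk continuous_const).continuousOn fun ρ _ => ⟨hxm ρ, mem_univ _⟩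
  · intro j hj ρ hρ
    rw [deriv_of_mem_femSpace hy hj hρ, deriv_of_mem_femSpace hη hj hρ]
  · intro j hj
    exact (continuousOn_applyH hΩ ha hγ (nodalSlope_ne_zero hx hx' hj) hx.1.continuousOn
      (hy.1.sub hx.1).continuousOn fun ρ _ => hxm ρ).inner hη.1.continuousOn
  · intro j hj ρ hρ
    rw [deriv_of_mem_femSpace hx hj hρ]

/-- Interpolation realises every vector of nodal values as a test function, so the two systems of
equations coincide up to the factor 1/(2J). -/
theorem isStep_iff (hΩ : IsOpen Ω) (ha : IsWeight Ω a) (hγ : IsAnisotropy Ω γ)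
    (hΦ : IsSplitting Ω (Phi a γ) Φplus Φminus) (hx : x ∈ femSpace J)
    (hx' : OnElements J fun ρ => deriv x ρ ≠ 0) (hxΩ : range x ⊆ Ω) (τ : ℝ) {y : ℝ → Plane}
    (hy : y ∈ femSpace J) (hyΩ : range y ⊆ Ω) :
    IsStep Ω a γ Φplus Φminus J τ x y ↔ ∀ Y, stepForm
      (fun c : QuadIndex J => applyH a γ (quadValue c (nodal J x)) (quadSlope c (nodal J x)))
      (Phi a γ) Φplus Φminus quadValue quadSlope (nodal J x) τ (nodal J y) Y = 0 := by
  have hJ : (1 : ℝ) / (2 * J) ≠ 0 := by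
    have := cast_pos_of_neZero (J := J)
    positivity
  constructor
  · intro h Y
    have := h.eq_zero _ (interp_mem_femSpace Y)
    rw [scheme_eq_stepForm hΩ ha hγ hΦ hx hx' hxΩ τ hy hyΩ (interp_mem_femSpace Y),
      nodal_interp] at this
    exact (mul_eq_zero.mp this).resolve_left hJ
  · intro h
    refine ⟨hy, hyΩ, fun η hη => ?_⟩
    rw [scheme_eq_stepForm hΩ ha hγ hΦ hx hx' hxΩ τ hy hyΩ hη, h, mul_zero]

/-! ### Coercivity constants -/

/-- Coercivity is assumed in the open elements only; with the slope of the element held fixed it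
passes to the end points by continuity. -/
theorem applyH_coercive_at_quadrature_points {C₀ : ℝ} (hΩ : IsOpen Ω) (ha : IsWeight Ω a)
    (hγ : IsAnisotropy Ω γ) (hx : x ∈ femSpace J)
    (hx' : OnElements J fun ρ => deriv x ρ ≠ 0) (hxΩ : range x ⊆ Ω)
    (hC : OnElements J fun ρ => ∀ ξ : Plane,
      C₀ * ‖ξ‖ ^ 2 ≤ ⟪applyH a γ (x ρ) (deriv x ρ) ξ, ξ⟫) (c : QuadIndex J) (ξ : Plane) :
    C₀ * ‖ξ‖ ^ 2 ≤
      ⟪applyH a γ (quadValue c (nodal J x)) (quadSlope c (nodal J x)) ξ, ξ⟫ := by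
  rw [quadValue_nodal hx.2.1, quadSlope_apply]
  have hj : (c.1 : ℕ) < J := c.1.2
  have hlt := node_lt_node_succ (J := J) c.1
  have hcont : ContinuousOn
      (fun ρ => ⟪applyH a γ (x ρ) (nodalSlope (nodal J x) c.1) ξ, ξ⟫)
      (Icc (node J c.1) (node J (c.1 + 1))) :=
    (continuousOn_applyH hΩ ha hγ (nodalSlope_ne_zero hx hx' hj) hx.1.continuousOn
      continuousOn_const fun ρ _ => hxΩ (mem_range_self ρ)).inner continuousOn_const
  rw [← closure_Ioo hlt.ne] at hcont
  refine le_on_closure (s := Ioo (node J c.1) (node J (c.1 + 1)))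
    (f := fun _ => C₀ * ‖ξ‖ ^ 2) (fun ρ hρ => ?_) continuousOn_const hcont ?_
  · rw [← deriv_of_mem_femSpace hx hj hρ]
    exact hC _ hj ρ hρ ξ
  · rw [closure_Ioo hlt.ne]
    exact c.mem_Icc

theorem exists_isCoercivityConst (hΩ : IsOpen Ω) (ha : IsWeight Ω a) (hγ : IsAnisotropy Ω γ)
    (hΦ : IsSplitting Ω (Phi a γ) Φplus Φminus) (hx : x ∈ femSpace J)
    (hx' : OnElements J fun ρ => deriv x ρ ≠ 0) {K : Set Plane} (hK : IsCompact K) (hKΩ : K ⊆ Ω)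
    (hxK : range x ⊆ K) : ∃ C₀, IsCoercivityConst a γ J x K C₀ := by
  have hop : IsOpen (Ω ×ˢ (univ : Set Plane)) := hΩ.prod isOpen_univ
  obtain ⟨α, hα, m, hm, S, hS, hαK, hmK, hSK⟩ := exists_uniform_bounds hΩ ha hγ hK hKΩ
  obtain ⟨c, hc, hcK⟩ := exists_Phi_strongly_monotone hΩ ha hγ
    (fun z hz => differentiableAt_snd hop hΦ.contDiffOn ⟨hz, mem_univ _⟩) hK hKΩ
  -- The smallest slope length l is positive because there are finitely many elements. It enters
  -- only the cruder lower bound for `H`, through γ(z, p^⊥) ≥ m l.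
  obtain ⟨j₀, hj₀⟩ := Finite.exists_min fun j : Fin J => ‖nodalSlope (nodal J x) j‖
  set l := ‖nodalSlope (nodal J x) j₀‖
  have hl : 0 < l := norm_pos_iff.mpr (nodalSlope_ne_zero hx hx' j₀.2)
  have hγ' : ∀ z ∈ K, ∀ p, α * (m * ‖p‖) ≤ a z * γ z (perp p) := fun z hz p => by
    have := hmK z hz (perp p)
    rw [norm_perp] at this
    exact mul_le_mul (hαK z hz) this (by positivity) (ha.pos z (hKΩ hz)).le
  refine ⟨min c (min (1 / 2 * (α * m) ^ 2) ((α * (m * l)) ^ 2 / S ^ 2)),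
    lt_min hc (lt_min (by positivity) (by positivity)), fun z hz p => ?_, fun z hz p q => ?_,
    fun j hj ρ hρ ξ => ?_⟩
  · calc _ ≤ 1 / 2 * (α * m) ^ 2 * ‖p‖ ^ 2 := by
          gcongr; exact (min_le_right _ _).trans (min_le_left _ _)
      _ = 1 / 2 * (α * (m * ‖p‖)) ^ 2 := by ring
      _ ≤ 1 / 2 * (a z * γ z (perp p)) ^ 2 :=
          mul_le_mul_of_nonneg_left (pow_le_pow_left₀ (by positivity) (hγ' z hz p) 2) (by norm_num)
      _ = _ := by rw [Phi]; ring
  · refine le_trans ?_ (hcK z hz p q)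
    gcongr
    exact min_le_left _ _
  · have hxρ := hxK (mem_range_self ρ)
    rw [deriv_of_mem_femSpace hx hj hρ, inner_applyH]
    set p := nodalSlope (nodal J x) j
    have hp : p ≠ 0 := nodalSlope_ne_zero hx hx' hj
    have hpp : perp p ≠ 0 := mt perp_eq_zero_iff.mp hp
    have hlp : l ≤ ‖p‖ := hj₀ ⟨j, hj⟩
    have hg : 0 < ‖gradP γ (x ρ) (perp p)‖ :=
      norm_pos_iff.mpr (hγ.gradP_ne_zero (hKΩ hxρ) hpp)
    gcongr
    calc _ ≤ (α * (m * l)) ^ 2 / S ^ 2 := (min_le_right _ _).trans (min_le_right _ _)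
      _ ≤ (a (x ρ) * γ (x ρ) (perp p)) ^ 2 / ‖gradP γ (x ρ) (perp p)‖ ^ 2 := by
          refine div_le_div₀ (sq_nonneg _) (pow_le_pow_left₀ (by positivity) ?_ 2) (by positivity)
            (pow_le_pow_left₀ hg.le (hSK _ hxρ _ hpp) 2)
          exact le_trans (by gcongr) (hγ' _ hxρ p)
      _ = _ := by rw [mul_pow]

theorem isCompact_setOf_quadValue_sub_le (X : ZMod J → Plane) (R : ℝ) :
    IsCompact {Y : ZMod J → Plane | ∀ c : QuadIndex J, ‖quadValue c (Y - X)‖ ≤ R} := by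
  refine (isCompact_closedBall X R).of_isClosed_subset ?_ fun Y hY => ?_
  · simp only [ofPred_forall]
    exact isClosed_iInter fun c => isClosed_le (by fun_prop) continuous_const
  · have h : ∀ k, ‖Y k - X k‖ ≤ R := fun k => by
      simpa [quadValue_val] using hY (⟨k.val, ZMod.val_lt k⟩, false)
    rw [mem_closedBall_iff_norm, pi_norm_le_iff_of_nonneg ((norm_nonneg _).trans (h 0))]
    exact h

/-- Existence and uniqueness for one step of the scheme. -/
theorem existsUnique_isStep (hΩ : IsOpen Ω) (ha : IsWeight Ω a) (hγ : IsAnisotropy Ω γ)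
    (hΦ : IsSplitting Ω (Phi a γ) Φplus Φminus) (hx : x ∈ femSpace J)
    (hx' : OnElements J fun ρ => deriv x ρ ≠ 0) (hxΩ : range x ⊆ Ω) {R C₀ L τ : ℝ} (hR : 0 < R)
    (hRΩ : nbhd x R ⊆ Ω) (hC : IsCoercivityConst a γ J x (nbhd x R) C₀) (hL : 0 ≤ L)
    (hplus : GradZLipschitz (nbhd x R) Φplus L) (hminus : GradZLipschitz (nbhd x R) Φminus L)
    (hτ : 0 < τ)
    (hτR : τ * J * (4 * (|energy J (Phi a γ) x| + 1)) ≤ R ^ 2 * C₀)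
    (hτL : τ * J * (16 * L ^ 2 * (|energy J (Phi a γ) x| / C₀ + 1)) ≤ C₀ ^ 2) :
    ∃! y : ℝ → Plane, IsStep Ω a γ Φplus Φminus J τ x y ∧ range y ⊆ nbhd x R := by
  have hJ := cast_pos_of_neZero (J := J)
  have hC0 := hC.pos
  set e := energy J (Phi a γ) x with he
  have hsum : ∑ c : QuadIndex J, Phi a γ (quadValue c (nodal J x)) (quadSlope c (nodal J x)) =
      2 * J * e := by
    rw [he, energy_eq hΦ hx hxΩ]
    field_simp
  -- The slope bound N is chosen so that C₀N² = 2J(|e| + C₀), which strictly exceeds the quadrature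
  -- sum 2Je.
  have hN2 : Real.sqrt (2 * J * (|e| / C₀ + 1)) ^ 2 = 2 * J * (|e| / C₀ + 1) :=
    Real.sq_sqrt (by positivity)
  have hmem : ∀ y ∈ femSpace J, range y ⊆ nbhd x R → ∀ c : QuadIndex J,
      quadValue c (nodal J y) ∈ nbhd x R := fun y hy h c => by
    rw [quadValue_nodal hy.2.1]; exact h (mem_range_self _)
  obtain ⟨⟨Y, hYR, hY⟩, huniq⟩ := existsUnique_stepForm_eq_zero
    (A := fun c : QuadIndex J => applyH a γ (quadValue c (nodal J x)) (quadSlope c (nodal J x)))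
    (V := quadValue) (D := quadSlope) (x := nodal J x) (τ := τ)
    (N := Real.sqrt (2 * J * (|e| / C₀ + 1)))
    hΩ hΦ hRΩ (fun c => continuous_applyH _ _) (fun c => applyH_sub _ _)
    (applyH_coercive_at_quadrature_points hΩ ha hγ hx hx' hxΩ hC.matH) hC0 hC.phi hC.gradPhi
    hL hplus hminus hτ (Real.sqrt_nonneg _) hR.le
    (by
      rw [hN2]
      calc _ = τ * J * (16 * L ^ 2 * (|e| / C₀ + 1)) := by ring
        _ ≤ _ := hτL)
    (by
      rw [hsum, hN2]
      have h1 : C₀ * (2 * J * (|e| / C₀ + 1)) = 2 * J * (|e| + C₀) := by field_simp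
      rw [h1]
      gcongr
      linarith [le_abs_self e])
    (by
      rw [hsum, div_mul_eq_mul_div, lt_div_iff₀ hτ]
      have h1 : 0 < τ * J := by positivity
      have h2 : 2 * J * e * τ ≤ τ * J * (2 * |e|) := by
        have := mul_le_mul_of_nonneg_left (le_abs_self e) h1.le
        linarith
      have h3 : τ * J * (2 * |e|) < τ * J * (4 * (|e| + 1)) := by
        gcongr
        · norm_num
        · exact lt_add_one _
      linarith)
    (fun c => by
      rw [quadValue_nodal hx.2.1]
      exact closedBall_subset_nbhd _ R)
    (isCompact_setOf_quadValue_sub_le _ R)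
  have hrange : range (interp Y) ⊆ nbhd x R :=
    range_subset_nbhd hx (interp_mem_femSpace Y) (by rwa [nodal_interp])
  have hiff := fun (y : ℝ → Plane) hy hyR =>
    isStep_iff hΩ ha hγ hΦ hx hx' hxΩ τ (y := y) hy (subset_trans hyR hRΩ)
  refine ⟨interp Y, ⟨(hiff _ (interp_mem_femSpace Y) hrange).mpr (by rwa [nodal_interp]), hrange⟩,
    fun y ⟨hy, hyR⟩ => ?_⟩
  have hV := huniq (nodal J y) (nodal J (interp Y)) (hmem y hy.mem hyR)
    (hmem _ (interp_mem_femSpace Y) hrange) ((hiff y hy.mem hyR).mp hy) (by rwa [nodal_interp])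
  refine eq_of_nodal_eq hy.mem (interp_mem_femSpace Y) (funext fun k => ?_)
  simpa only [quadValue_val] using hV (⟨k.val, ZMod.val_lt k⟩, false)

end Scheme

end AnisoFlow

end

/-! ### The time step threshold -/

theorem theorem2 :
    ∃ δ : ℝ → ℝ → ℝ → ℝ → ℝ,
      (∀ R C₀ L e : ℝ, 0 < R → 0 < C₀ → 0 ≤ L → 0 < δ R C₀ L e) ∧
      ∀ (Ω : Set AnisoFlow.Plane) (a : AnisoFlow.Plane → ℝ)
        (γ Φplus Φminus : AnisoFlow.Plane → AnisoFlow.Plane → ℝ)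
        (J : ℕ) (x : ℝ → AnisoFlow.Plane),
        IsOpen Ω → Convex ℝ Ω →
        AnisoFlow.IsWeight Ω a →
        AnisoFlow.IsAnisotropy Ω γ →
        AnisoFlow.IsSplitting Ω (AnisoFlow.Phi a γ) Φplus Φminus →
        3 ≤ J →
        x ∈ AnisoFlow.femSpace J →
        AnisoFlow.OnElements J (fun ρ => deriv x ρ ≠ 0) →
        Set.range x ⊆ Ω →
        (∃ R > 0, AnisoFlow.nbhd x R ⊆ Ω) ∧
        ∀ R > 0, AnisoFlow.nbhd x R ⊆ Ω →
          (∃ C₀, AnisoFlow.IsCoercivityConst a γ J x (AnisoFlow.nbhd x R) C₀) ∧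
          ∀ C₀ L : ℝ,
            AnisoFlow.IsCoercivityConst a γ J x (AnisoFlow.nbhd x R) C₀ →
            0 ≤ L →
            AnisoFlow.GradZLipschitz (AnisoFlow.nbhd x R) Φplus L →
            AnisoFlow.GradZLipschitz (AnisoFlow.nbhd x R) Φminus L →
            ∀ τ : ℝ, 0 < τ →
              τ ≤ δ R C₀ L (AnisoFlow.energy J (AnisoFlow.Phi a γ) x) * (1 / (J : ℝ)) →
              ∃! y : ℝ → AnisoFlow.Plane,
                AnisoFlow.IsStep Ω a γ Φplus Φminus J τ x y ∧
                Set.range y ⊆ AnisoFlow.nbhd x R := by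
  -- The first entry keeps the solution strictly inside the R-neighbourhood at the nodes; the second
  -- is 8L²N²τ ≤ C₀² with the chosen N. The 1 added to the second denominator keeps it positive when
  -- L = 0.
  refine ⟨fun R C₀ L e => min (R ^ 2 * C₀ / (4 * (|e| + 1)))
    (C₀ ^ 2 / (16 * L ^ 2 * (|e| / C₀ + 1) + 1)), fun R C₀ L e hR hC hL =>
      lt_min (by positivity) (by positivity), ?_⟩
  intro Ω a γ Φplus Φminus J x hΩ _ ha hγ hΦ hJ hx hx' hxΩ
  have : NeZero J := ⟨by omega⟩
  have hxc := AnisoFlow.isCompact_range_of_mem_femSpace hx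
  refine ⟨AnisoFlow.exists_nbhd_subset hΩ hxc hxΩ, fun R hR hRΩ => ⟨?_, ?_⟩⟩
  · refine AnisoFlow.exists_isCoercivityConst hΩ ha hγ hΦ hx hx'
      (AnisoFlow.isCompact_nbhd hxc hR.le) hRΩ ?_
    rintro _ ⟨ρ, rfl⟩
    exact AnisoFlow.closedBall_subset_nbhd ρ R (Metric.mem_closedBall_self hR.le)
  · intro C₀ L hC hL hplus hminus τ hτ hτδ
    have hJ0 := AnisoFlow.cast_pos_of_neZero (J := J)
    have hC0 := hC.pos
    set e := AnisoFlow.energy J (AnisoFlow.Phi a γ) x with he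
    rw [mul_one_div, le_div_iff₀ hJ0] at hτδ
    have h1 := hτδ.trans (min_le_left _ _)
    have h2 := hτδ.trans (min_le_right _ _)
    rw [le_div_iff₀ (by positivity)] at h1 h2
    refine AnisoFlow.existsUnique_isStep hΩ ha hγ hΦ hx hx' hxΩ hR hRΩ hC hL hplus hminus hτ h1 ?_
    have : 0 ≤ τ * J := by positivity
    linarith
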